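/- **Lemma.** Terminal Steiner Tree parameterized by $k+|T|$ is fixed-parameter tractable. Here an instance of Terminal Steiner Tree consists of a finite simple undirected graph $G=(V,E)$, a set $T\subseteq V$ of terminals and a positive integer $k$, and the question is whether $G$ has a subgraph $H$ with at most $k+|T|$ vertices such that $H$ is a tree, $H$ contains all vertices of $T$, and every vertex of $T$ is a leaf of $H$ (that is, has degree exactly one in $H$). The claim is that there are an algorithm, a computable function $f:\mathbb{N}\to\mathbb{N}$ and a constant $c$ such that the algorithm, given a pair $(x,p)\in\{0,1\}^*\times\mathbb{N}$, decides in at most $f(p)\cdot(|x|+1)^{c}$ steps (on a random access machine with unit-cost addition, truncated subtraction and halving) whether $x$ is the binary encoding of a yes-instance $(G,T,k)$ with $k+|T|=p$. (The encoding lists $|V|$ in unary, the characteristic vector of $T$, the adjacency matrix of $G$, and $k$ in binary.) -/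

import Mathlib

/-! ### Random access machines with a step count

Structured programs for the usual random access machine: registers and an addressable memory hold
natural numbers, and the arithmetic instructions are addition, truncated subtraction and halving,
each counted as one step. There is no multiplication, so that a number occurring after `t` steps has
`O(t)` more bits than the numbers of the input, and running times agree with those of Turing
machines up to a polynomial. -/

namespace RAM

/-- The configuration of a random access machine. -/
structure State where
  /-- the registers, addressed directly -/
  reg : ℕ → ℕ
  /-- the memory, addressed through registers -/
  mem : ℕ → ℕ

namespace State

def setReg (s : State) (r v : ℕ) : State := { s with reg := Function.update s.reg r v }

def setMem (s : State) (a v : ℕ) : State := { s with mem := Function.update s.mem a v }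

end State

/-- Programs. Only finitely many registers occur in a program. -/
inductive Prog where
  | skip : Prog
  /-- `reg r := c` -/
  | const (r c : ℕ) : Prog
  /-- `reg r := reg a + reg b` -/
  | add (r a b : ℕ) : Prog
  /-- `reg r := max (reg a - reg b) 0` -/
  | sub (r a b : ℕ) : Prog
  /-- `reg r := ⌊reg a / 2⌋` -/
  | half (r a : ℕ) : Prog
  /-- `reg r := mem (reg a)` -/
  | load (r a : ℕ) : Prog
  /-- `mem (reg a) := reg b` -/
  | store (a b : ℕ) : Prog
  /-- `p` followed by `q` -/
  | seq (p q : Prog) : Prog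
  /-- `p` if `reg a ≠ 0`, and `q` otherwise -/
  | cond (a : ℕ) (p q : Prog) : Prog
  /-- repeat `p` as long as `reg a ≠ 0` -/
  | loop (a : ℕ) (p : Prog) : Prog

/-- `Runs p s s' t`: started in `s`, the program `p` halts in `s'` after exactly `t` steps. Every
instruction and every evaluation of a test is one step. -/
inductive Runs : Prog → State → State → ℕ → Prop
  | skip (s : State) : Runs .skip s s 1
  | const (r c : ℕ) (s : State) : Runs (.const r c) s (s.setReg r c) 1
  | add (r a b : ℕ) (s : State) : Runs (.add r a b) s (s.setReg r (s.reg a + s.reg b)) 1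
  | sub (r a b : ℕ) (s : State) : Runs (.sub r a b) s (s.setReg r (s.reg a - s.reg b)) 1
  | half (r a : ℕ) (s : State) : Runs (.half r a) s (s.setReg r (s.reg a / 2)) 1
  | load (r a : ℕ) (s : State) : Runs (.load r a) s (s.setReg r (s.mem (s.reg a))) 1
  | store (a b : ℕ) (s : State) : Runs (.store a b) s (s.setMem (s.reg a) (s.reg b)) 1
  | seq {p q : Prog} {s s' s'' : State} {t t' : ℕ} :
      Runs p s s' t → Runs q s' s'' t' → Runs (.seq p q) s s'' (t + t')
  | condTrue {a : ℕ} {p q : Prog} {s s' : State} {t : ℕ} :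
      s.reg a ≠ 0 → Runs p s s' t → Runs (.cond a p q) s s' (t + 1)
  | condFalse {a : ℕ} {p q : Prog} {s s' : State} {t : ℕ} :
      s.reg a = 0 → Runs q s s' t → Runs (.cond a p q) s s' (t + 1)
  | loopDone {a : ℕ} {p : Prog} {s : State} :
      s.reg a = 0 → Runs (.loop a p) s s 1
  | loopStep {a : ℕ} {p : Prog} {s s' s'' : State} {t t' : ℕ} :
      s.reg a ≠ 0 → Runs p s s' t → Runs (.loop a p) s' s'' t' →
        Runs (.loop a p) s s'' (t + t' + 1)

/-- Programs are deterministic: the final state and the number of steps are determined by the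
program and the initial state. -/
theorem Runs.deterministic {p : Prog} {s s₁ s₂ : State} {t₁ t₂ : ℕ}
    (h₁ : Runs p s s₁ t₁) (h₂ : Runs p s s₂ t₂) : s₁ = s₂ ∧ t₁ = t₂ := by
  induction h₁ generalizing s₂ t₂ with
  | seq _ _ ih ih' =>
    cases h₂ with
    | seq k k' =>
      obtain ⟨rfl, rfl⟩ := ih k
      obtain ⟨rfl, rfl⟩ := ih' k'
      exact ⟨rfl, rfl⟩
  | condTrue ha _ ih =>
    cases h₂ with
    | condTrue _ k => obtain ⟨rfl, rfl⟩ := ih k; exact ⟨rfl, rfl⟩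
    | condFalse hb _ => exact absurd hb ha
  | condFalse ha _ ih =>
    cases h₂ with
    | condTrue hb _ => exact absurd ha hb
    | condFalse _ k => obtain ⟨rfl, rfl⟩ := ih k; exact ⟨rfl, rfl⟩
  | loopDone ha =>
    cases h₂ with
    | loopDone _ => exact ⟨rfl, rfl⟩
    | loopStep hb _ _ => exact absurd ha hb
  | loopStep ha _ _ ih ih' =>
    cases h₂ with
    | loopDone hb => exact absurd hb ha
    | loopStep _ k k' =>
      obtain ⟨rfl, rfl⟩ := ih k
      obtain ⟨rfl, rfl⟩ := ih' k'
      exact ⟨rfl, rfl⟩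
  | _ => cases h₂; exact ⟨rfl, rfl⟩

/-- The initial state on input `(x, k)`: register `0` holds `|x|`, register `1` holds `k`, the bits
of `x` are the first `|x|` memory cells, and everything else is `0`. -/
def init (x : List Bool) (k : ℕ) : State where
  reg r := if r = 0 then x.length else if r = 1 then k else 0
  mem i := if x[i]? = some true then 1 else 0

end RAM

/-- A parameterized problem is a set of pairs `(x, k)` of a binary string and a parameter. -/
abbrev ParamProblem : Type := Set (List Bool × ℕ)

/-- A parameterized problem is fixed-parameter tractable if some program decides every `(x, k)` in
`f(k) * |x| ^ O(1)` steps, for a computable function `f`. The program accepts if it halts with a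
nonzero value in register `0`. (`|x| + 1` instead of `|x|` accounts for the empty string.) -/
def ParamProblem.IsFPT (L : ParamProblem) : Prop :=
  ∃ (p : RAM.Prog) (f : ℕ → ℕ) (c : ℕ), Computable f ∧
    ∀ (x : List Bool) (k : ℕ), ∃ (s : RAM.State) (t : ℕ),
      RAM.Runs p (RAM.init x k) s t ∧
      t ≤ f k * (x.length + 1) ^ c ∧
      (s.reg 0 ≠ 0 ↔ (x, k) ∈ L)

/-! ### Terminal Steiner Tree -/

/-- An instance: a finite undirected graph, a set of terminals and a positive integer. -/
structure TSTInstance where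
  n : ℕ
  G : SimpleGraph (Fin n)
  T : Finset (Fin n)
  k : ℕ
  k_pos : 0 < k

namespace TSTInstance

/-- `H` is a terminal Steiner tree for `T`: it is a tree and each vertex of `T` is a leaf of `H`,
that is, a vertex of `H` of degree one in `H`. -/
def IsTerminalSteinerTree {V : Type*} {G : SimpleGraph V} (T : Finset V) (H : G.Subgraph) : Prop :=
  H.coe.IsTree ∧ ∀ v ∈ T, v ∈ H.verts ∧ (H.neighborSet v).ncard = 1

/-- There is a terminal Steiner tree with at most `k + |T|` vertices. -/
def IsYes (I : TSTInstance) : Prop :=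
  ∃ H : I.G.Subgraph, IsTerminalSteinerTree I.T H ∧ H.verts.ncard ≤ I.k + I.T.card

/-- The parameter `k + |T|`. -/
def param (I : TSTInstance) : ℕ := I.k + I.T.card

open Classical in
/-- The instance as a binary string: `n` in unary, ended by a `0`; the characteristic vector of `T`;
the adjacency matrix of `G`, row by row; and `k` in binary, least significant bit first. -/
noncomputable def encode (I : TSTInstance) : List Bool :=
  List.replicate I.n true ++ [false] ++
    List.ofFn (fun v : Fin I.n => decide (v ∈ I.T)) ++
    (List.ofFn fun u : Fin I.n => List.ofFn fun v : Fin I.n => decide (I.G.Adj u v)).flatten ++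
    I.k.bits

end TSTInstance

/-- Terminal Steiner Tree parameterized by `k + |T|`. -/
def terminalSteinerTree : ParamProblem :=
  {y | ∃ I : TSTInstance, I.encode = y.1 ∧ I.param = y.2 ∧ I.IsYes}

/-! Apart from the case of two adjacent terminals, a terminal Steiner tree exists if and only if
some nonempty set of at most `k` non-terminals induces a connected subgraph in which every terminal
has a neighbor: attach the terminals as leaves to a spanning tree. Equivalently, some rooted tree
with `k + |T|` nodes, of which the last `|T|` hang from the others, has a homomorphism to the graph
with loops at all vertices that sends the last nodes to the terminals and the others to
non-terminals. The loops let several nodes share a vertex, so that exactly `k` internal nodes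
suffice.

With `p = k + |T|`, numbers below `p ^ p` list the parent functions of all such trees by their
digits. For each tree, the program decides whether there is a homomorphism by dynamic programming:
it keeps for every node the set of its possible images, and removes the last node after it has
restricted the images of its parent to those that have an image of the removed node as a neighbor.

The program is written in a language of counted loops that is translated to the random access
machine. No loop changes the variables that bound it or the loops inside it, so the running time is
polynomial in the values of these variables, which are at most `|x| + p + p ^ p`. -/

/-! ### Terminal Steiner trees as tree homomorphisms -/

namespace TSTInstance

section Graph

variable {V W : Type*} {G : SimpleGraph V}

theorem connected_of_surjective {K : SimpleGraph W} (hG : G.Connected) {f : V → W}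
    (hf : Function.Surjective f) (h : ∀ a b, G.Adj a b → K.Reachable (f a) (f b)) :
    K.Connected := by
  have reachable_map : ∀ a b, K.Reachable (f a) (f b) := by
    intro a b
    have hab := hG.preconnected a b
    rw [SimpleGraph.reachable_iff_reflTransGen] at hab
    induction hab with
    | refl => exact .refl _
    | tail _ hbc ih => exact ih.trans (h _ _ hbc)
  have := hG.nonempty.map f
  refine ⟨fun u v => ?_⟩
  obtain ⟨a, rfl⟩ := hf u
  obtain ⟨b, rfl⟩ := hf v
  exact reachable_map a b

theorem exists_isTree_le_of_coe_connected {K : G.Subgraph} (hK : K.coe.Connected) :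
    ∃ H ≤ K, H.verts = K.verts ∧ H.coe.IsTree := by
  obtain ⟨F, hF, hFtree⟩ := hK.exists_isTree_le
  let H : G.Subgraph :=
    { verts := K.verts
      Adj := fun a b => ∃ (ha : a ∈ K.verts) (hb : b ∈ K.verts), F.Adj ⟨a, ha⟩ ⟨b, hb⟩
      adj_sub := fun ⟨_, _, h⟩ => K.adj_sub (hF h)
      edge_vert := fun ⟨ha, _, _⟩ => ha
      symm := ⟨fun _ _ ⟨ha, hb, h⟩ => ⟨hb, ha, h.symm⟩⟩ }
  have hcoe : H.coe = F := by
    ext a b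
    exact ⟨fun ⟨_, _, h⟩ => h, fun h => ⟨a.2, b.2, h⟩⟩
  exact ⟨H, ⟨le_rfl, fun _ _ ⟨_, _, h⟩ => hF h⟩, rfl, hcoe ▸ hFtree⟩

/-- The subgraph induced on `S`, together with one edge from each vertex `t` of `T` to its
attachment vertex `att t` in `S`. -/
def attachLeaves (S T : Set V) (att : V → V) (hatt : ∀ t ∈ T, att t ∈ S ∧ G.Adj t (att t)) :
    G.Subgraph where
  verts := S ∪ T
  Adj a b := (a ∈ S ∧ b ∈ S ∧ G.Adj a b) ∨ (a ∈ T ∧ b = att a) ∨ (b ∈ T ∧ a = att b)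
  adj_sub := by
    rintro a b (⟨_, _, h⟩ | ⟨ha, rfl⟩ | ⟨hb, rfl⟩)
    exacts [h, (hatt a ha).2, (hatt b hb).2.symm]
  edge_vert := by
    rintro a b (⟨ha, _⟩ | ⟨ha, _⟩ | ⟨hb, rfl⟩)
    exacts [.inl ha, .inr ha, .inl (hatt b hb).1]
  symm := ⟨by
    rintro a b (⟨ha, hb, h⟩ | h | h)
    exacts [.inl ⟨hb, ha, h.symm⟩, .inr (.inr h), .inr (.inl h)]⟩

theorem attachLeaves_coe_connected {S T : Set V} {att : V → V}
    (hatt : ∀ t ∈ T, att t ∈ S ∧ G.Adj t (att t)) (hS : (G.induce S).Connected) :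
    (attachLeaves S T att hatt).coe.Connected := by
  set K := attachLeaves S T att hatt
  obtain ⟨r⟩ := hS.nonempty
  let incl : G.induce S →g K.coe :=
    { toFun := fun v => ⟨v, .inl v.2⟩
      map_rel' := fun {a b} h => .inl ⟨a.2, b.2, h⟩ }
  have reachable_root : ∀ w : K.verts, K.coe.Reachable (incl r) w := by
    rintro ⟨w, hw | hw⟩
    · exact (hS.preconnected r ⟨w, hw⟩).map incl
    · have hadj : K.coe.Adj (incl ⟨att w, (hatt w hw).1⟩) ⟨w, .inr hw⟩ := .inr (.inr ⟨hw, rfl⟩)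
      exact ((hS.preconnected r _).map incl).trans hadj.reachable
  have : Nonempty K.verts := ⟨incl r⟩
  exact ⟨fun a b => (reachable_root a).symm.trans (reachable_root b)⟩

theorem exists_isTerminalSteinerTree {S : Set V} {T : Finset V} (hST : ∀ v ∈ S, v ∉ T)
    (hS : (G.induce S).Connected) (hdom : ∀ t ∈ T, ∃ s ∈ S, G.Adj t s) :
    ∃ H : G.Subgraph, IsTerminalSteinerTree T H ∧ H.verts = S ∪ T := by
  choose! att hatt using hdom
  obtain ⟨H, hle, hverts, hH⟩ :=
    exists_isTree_le_of_coe_connected (attachLeaves_coe_connected (T := (T : Set V)) hatt hS)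
  replace hverts : H.verts = S ∪ T := hverts
  have hmem : ∀ t ∈ T, t ∈ H.verts := fun t ht => hverts ▸ .inr ht
  have adj_imp : ∀ t ∈ T, ∀ w, H.Adj t w → w = att t := by
    rintro t ht w htw
    rcases hle.2 htw with ⟨htS, _⟩ | ⟨_, hw⟩ | ⟨hwT, rfl⟩
    exacts [absurd ht (hST t htS), hw, absurd ht (hST _ (hatt w hwT).1)]
  obtain ⟨r⟩ := hS.nonempty
  have exists_adj : ∀ t ∈ T, ∃ w, H.Adj t w := by
    intro t ht
    have hne : t ≠ r := fun h => hST r r.2 (h ▸ ht)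
    have : Nontrivial H.verts :=
      ⟨⟨t, hmem t ht⟩, ⟨r, hverts ▸ .inl r.2⟩, fun h => hne (congrArg Subtype.val h)⟩
    obtain ⟨w, hw⟩ := hH.connected.preconnected.exists_adj_of_nontrivial ⟨t, hmem t ht⟩
    exact ⟨w, hw⟩
  refine ⟨H, ⟨hH, fun t ht => ⟨hmem t ht, Set.ncard_eq_one.2 ⟨att t, ?_⟩⟩⟩, hverts⟩
  obtain ⟨w, hw⟩ := exists_adj t ht
  obtain rfl := adj_imp t ht w hw
  exact Set.eq_singleton_iff_unique_mem.2 ⟨hw, adj_imp t ht⟩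

theorem IsTerminalSteinerTree.exists_unique_adj {T : Finset V} {H : G.Subgraph}
    (h : IsTerminalSteinerTree T H) {t : V} (ht : t ∈ T) : ∃ s, ∀ w, H.Adj t w ↔ w = s := by
  obtain ⟨s, hs⟩ := Set.ncard_eq_one.1 (h.2 t ht).2
  exact ⟨s, fun w => Set.ext_iff.1 hs w⟩

theorem IsTerminalSteinerTree.eq_pair_of_adj [DecidableEq V] {T : Finset V} {H : G.Subgraph}
    (h : IsTerminalSteinerTree T H) {u v : V} (hu : u ∈ T) (hv : v ∈ T) (huv : H.Adj u v) :
    T = {u, v} := by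
  obtain ⟨u', hu'⟩ := h.exists_unique_adj hu
  obtain ⟨v', hv'⟩ := h.exists_unique_adj hv
  obtain rfl := (hu' v).1 huv
  obtain rfl := (hv' u).1 huv.symm
  have closed : ∀ w : H.verts, (w : V) = u ∨ (w : V) = v := by
    intro w
    have huw := h.1.connected.preconnected ⟨u, huv.fst_mem⟩ w
    rw [SimpleGraph.reachable_iff_reflTransGen] at huw
    induction huw with
    | refl => exact .inl rfl
    | @tail a b _ hab ih =>
      have hab : H.Adj a b := hab
      rcases ih with ha | ha
      · exact .inr ((hu' b).1 (ha ▸ hab))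
      · exact .inl ((hv' b).1 (ha ▸ hab))
  ext w
  simp only [Finset.mem_insert, Finset.mem_singleton]
  refine ⟨fun hw => closed ⟨w, (h.2 w hw).1⟩, ?_⟩
  rintro (rfl | rfl) <;> assumption

theorem IsTerminalSteinerTree.connected_diff {T : Finset V} {H : G.Subgraph}
    (h : IsTerminalSteinerTree T H) (hT : ∀ u ∈ T, ∀ v ∈ T, ¬ H.Adj u v) :
    (G.induce (H.verts \ T)).Connected ∧ ∀ t ∈ T, ∃ s ∈ H.verts \ T, G.Adj t s := by
  classical
  choose! nb hnb using fun t => h.exists_unique_adj (t := t)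
  have adj_nb : ∀ t ∈ T, H.Adj t (nb t) := fun t ht => (hnb t ht _).2 rfl
  have nb_mem : ∀ t ∈ T, nb t ∈ H.verts \ (T : Set V) := fun t ht =>
    ⟨(adj_nb t ht).snd_mem, fun hs => hT t ht _ hs (adj_nb t ht)⟩
  refine ⟨?_, fun t ht => ⟨nb t, nb_mem t ht, (adj_nb t ht).adj_sub⟩⟩
  let anchor : H.verts → (H.verts \ T : Set V) := fun w =>
    if hw : (w : V) ∈ T then ⟨nb w, nb_mem w hw⟩ else ⟨w, w.2, hw⟩
  refine connected_of_surjective h.1.connected (f := anchor) (fun s => ?_) (fun a b hab => ?_)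
  · exact ⟨⟨s, s.2.1⟩, dif_neg s.2.2⟩
  · have hab : H.Adj a b := hab
    by_cases ha : (a : V) ∈ T <;> by_cases hb : (b : V) ∈ T
    · exact absurd hab (hT a ha b hb)
    · simp only [anchor, dif_pos ha, dif_neg hb, ← (hnb a ha b).1 hab]
      rfl
    · simp only [anchor, dif_neg ha, dif_pos hb, ← (hnb b hb a).1 hab.symm]
      rfl
    · refine SimpleGraph.Adj.reachable ?_
      simp only [anchor, dif_neg ha, dif_neg hb]
      exact hab.adj_sub

theorem isTerminalSteinerTree_subgraphOfAdj [DecidableEq V] {u v : V} (h : G.Adj u v) :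
    IsTerminalSteinerTree {u, v} (G.subgraphOfAdj h) := by
  refine ⟨SimpleGraph.IsTree.coe_subgraphOfAdj h, fun w hw => ?_⟩
  simp only [Finset.mem_insert, Finset.mem_singleton] at hw
  refine ⟨by simpa using hw, ?_⟩
  rcases hw with rfl | rfl
  · rw [SimpleGraph.neighborSet_fst_subgraphOfAdj, Set.ncard_singleton]
  · rw [SimpleGraph.neighborSet_snd_subgraphOfAdj, Set.ncard_singleton]

theorem isYes_iff_exists_core (I : TSTInstance) :
    I.IsYes ↔ (I.T.card = 2 ∧ ∃ u ∈ I.T, ∃ v ∈ I.T, I.G.Adj u v) ∨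
      ∃ S : Set (Fin I.n), (I.G.induce S).Connected ∧ S.ncard ≤ I.k ∧ (∀ v ∈ S, v ∉ I.T) ∧
        ∀ t ∈ I.T, ∃ s ∈ S, I.G.Adj t s := by
  have := I.k_pos
  constructor
  · rintro ⟨H, hH, hcard⟩
    by_cases hT : ∃ u ∈ I.T, ∃ v ∈ I.T, H.Adj u v
    · obtain ⟨u, hu, v, hv, huv⟩ := hT
      refine .inl ⟨?_, u, hu, v, hv, huv.adj_sub⟩
      rw [hH.eq_pair_of_adj hu hv huv, Finset.card_pair huv.adj_sub.ne]
    · push Not at hT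
      obtain ⟨hconn, hdom⟩ := hH.connected_diff hT
      refine .inr ⟨_, hconn, ?_, fun v hv => hv.2, hdom⟩
      have hsub : (I.T : Set (Fin I.n)) ⊆ H.verts := fun t ht => (hH.2 t ht).1
      have := Set.ncard_sdiff_add_ncard_of_subset hsub
      rw [Set.ncard_coe_finset] at this
      omega
  · rintro (⟨hcard, u, hu, v, hv, huv⟩ | ⟨S, hconn, hcard, hST, hdom⟩)
    · have hpair : {u, v} = I.T := by
        refine Finset.eq_of_subset_of_card_le ?_ ?_
        · simp [Finset.insert_subset_iff, hu, hv]
        · rw [hcard, Finset.card_pair huv.ne]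
      refine ⟨_, hpair ▸ isTerminalSteinerTree_subgraphOfAdj huv, ?_⟩
      rw [SimpleGraph.subgraphOfAdj_verts, Set.ncard_pair huv.ne]
      omega
    · obtain ⟨H, hH, hverts⟩ := exists_isTerminalSteinerTree hST hconn hdom
      refine ⟨H, hH, ?_⟩
      rw [hverts]
      refine (Set.ncard_union_le _ _).trans ?_
      rw [Set.ncard_coe_finset]
      omega

end Graph

end TSTInstance

section SearchOrder

variable {V : Type*} {G : SimpleGraph V}

/-- A listing `φ 0, …, φ (k - 1)` of vertices, with repetitions, in which every member after the
first is adjacent or equal to the earlier member named by `par`. -/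
def IsSearchOrder (G : SimpleGraph V) (k : ℕ) (φ : ℕ → V) (par : ℕ → ℕ) : Prop :=
  ∀ j, 1 ≤ j → j < k → par j < j ∧ (G.Adj (φ (par j)) (φ j) ∨ φ (par j) = φ j)

theorem IsSearchOrder.connected {k : ℕ} {φ : ℕ → V} {par : ℕ → ℕ}
    (h : IsSearchOrder G k φ par) (hk : 0 < k) : (G.induce (φ '' Set.Iio k)).Connected := by
  have hmem : ∀ j, j < k → φ j ∈ φ '' Set.Iio k := fun j hj => ⟨j, hj, rfl⟩
  have reachable_first : ∀ j (hj : j < k),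
      (G.induce (φ '' Set.Iio k)).Reachable ⟨φ 0, hmem 0 hk⟩ ⟨φ j, hmem j hj⟩ := by
    intro j
    induction j using Nat.strong_induction_on with
    | _ j ih =>
      intro hj
      rcases Nat.eq_zero_or_pos j with rfl | h0
      · exact .refl _
      · obtain ⟨hlt, hadj | heq⟩ := h j h0 hj
        · exact (ih _ hlt (hlt.trans hj)).trans (SimpleGraph.Adj.reachable hadj)
        · simpa only [heq] using ih _ hlt (hlt.trans hj)
  have : Nonempty (φ '' Set.Iio k) := ⟨⟨φ 0, hmem 0 hk⟩⟩
  refine ⟨?_⟩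
  rintro ⟨_, a, ha, rfl⟩ ⟨_, b, hb, rfl⟩
  exact (reachable_first a ha).symm.trans (reachable_first b hb)

theorem IsSearchOrder.update {k a : ℕ} {φ : ℕ → V} {par : ℕ → ℕ} {v : V}
    (h : IsSearchOrder G k φ par) (ha : a < k) (hv : G.Adj (φ a) v) :
    IsSearchOrder G (k + 1) (Function.update φ k v) (Function.update par k a) := by
  intro j hj hjk
  rcases eq_or_ne j k with rfl | hne
  · rw [Function.update_self, Function.update_self, Function.update_of_ne ha.ne]
    exact ⟨ha, .inl hv⟩
  · obtain ⟨hlt, hadj⟩ := h j hj (by omega)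
    rw [Function.update_of_ne hne, Function.update_of_ne hne,
      Function.update_of_ne (by omega : par j ≠ k)]
    exact ⟨hlt, hadj⟩

theorem image_update_Iio_succ (φ : ℕ → V) (k : ℕ) (v : V) :
    Function.update φ k v '' Set.Iio (k + 1) = insert v (φ '' Set.Iio k) := by
  have hIio : Set.Iio (k + 1) = insert k (Set.Iio k) := by
    ext j
    simp only [Set.mem_Iio, Set.mem_insert_iff]
    omega
  rw [hIio, Set.image_insert_eq, Function.update_self]
  congr 1
  exact Set.image_congr fun j hj => Function.update_of_ne (Set.mem_Iio.1 hj).ne _ _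

theorem exists_mem_connected_induce_diff {S : Set V} (hfin : S.Finite) (hS : S.Nontrivial)
    (hconn : (G.induce S).Connected) :
    ∃ v ∈ S, (G.induce (S \ {v})).Connected ∧ ∃ u ∈ S \ {v}, G.Adj u v := by
  have := hfin.to_subtype
  have := hS.coe_sort
  obtain ⟨v, hv⟩ := hconn.exists_connected_induce_compl_singleton_of_finite_nontrivial
  refine ⟨v, v.2, ?_, ?_⟩
  · let incl : ({v}ᶜ : Set S) → (S \ {(v : V)} : Set V) := fun w =>
      ⟨w, w.1.2, fun h => w.2 (Subtype.ext h)⟩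
    refine TSTInstance.connected_of_surjective hv (f := incl) (fun w => ?_) fun a b hab => ?_
    · exact ⟨⟨⟨w, w.2.1⟩, fun h => w.2.2 (congrArg Subtype.val h)⟩, rfl⟩
    · exact SimpleGraph.Adj.reachable hab
  · obtain ⟨u, hu⟩ := hconn.preconnected.exists_adj_of_nontrivial v
    exact ⟨u, ⟨u.2, fun h => hu.ne (Subtype.ext h.symm)⟩, hu.symm⟩

theorem exists_isSearchOrder {S : Set V} (hfin : S.Finite) (hconn : (G.induce S).Connected)
    {k : ℕ} (hk : S.ncard ≤ k) : ∃ φ par, IsSearchOrder G k φ par ∧ φ '' Set.Iio k = S := by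
  induction k generalizing S with
  | zero =>
    have hpos := (Set.ncard_pos hfin).2 (Set.nonempty_coe_sort.1 hconn.nonempty)
    omega
  | succ k ih =>
    rcases S.subsingleton_or_nontrivial with hS | hS
    · obtain ⟨r, rfl⟩ := (Set.exists_eq_singleton_iff_nonempty_subsingleton).2
        ⟨Set.nonempty_coe_sort.1 hconn.nonempty, hS⟩
      exact ⟨fun _ => r, fun _ => 0, fun j hj _ => ⟨hj, .inr rfl⟩,
        Set.Nonempty.image_const ⟨k, k.lt_succ_self⟩ r⟩
    · obtain ⟨v, hvS, hconn', u, huS, huv⟩ := exists_mem_connected_induce_diff hfin hS hconn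
      have hcard : (S \ {v}).ncard ≤ k := by
        rw [Set.ncard_sdiff_singleton_of_mem hvS]
        omega
      obtain ⟨φ, par, hφ, himage⟩ := ih (hfin.subset Set.sdiff_subset) hconn' hcard
      obtain ⟨a, ha, rfl⟩ : u ∈ φ '' Set.Iio k := himage ▸ huS
      refine ⟨_, _, hφ.update ha huv, ?_⟩
      rw [image_update_Iio_succ, himage, Set.insert_sdiff_singleton, Set.insert_eq_of_mem hvS]

end SearchOrder

section TreeHom

variable {V : Type*}

/-- The nodes `0, …, J - 1` of the rooted tree with parent function `par` can be assigned to
vertices in their domains `D j`, such that each node is adjacent or equal to its parent. -/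
def TreeHom (D : ℕ → V → Prop) (A : V → V → Prop) (par : ℕ → ℕ) (J : ℕ) : Prop :=
  ∃ φ : ℕ → V, (∀ j < J, D j (φ j)) ∧
    ∀ j, 1 ≤ j → j < J → A (φ (par j)) (φ j) ∨ φ (par j) = φ j

variable {D D' : ℕ → V → Prop} {A : V → V → Prop} {par par' : ℕ → ℕ} {J : ℕ}

theorem treeHom_congr (hD : ∀ j < J, ∀ v, D j v ↔ D' j v)
    (hpar : ∀ j, 1 ≤ j → j < J → par j = par' j) :
    TreeHom D A par J ↔ TreeHom D' A par' J := by
  refine exists_congr fun φ => and_congr ?_ ?_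
  · exact forall₂_congr fun j hj => hD j hj _
  · exact forall₃_congr fun j hj hJ => by rw [hpar j hj hJ]

theorem treeHom_one : TreeHom D A par 1 ↔ ∃ v, D 0 v := by
  constructor
  · rintro ⟨φ, hφ, _⟩
    exact ⟨φ 0, hφ 0 one_pos⟩
  · rintro ⟨v, hv⟩
    refine ⟨fun _ => v, fun j hj => ?_, fun j h1 hj => ?_⟩
    · rwa [Nat.lt_one_iff.1 hj]
    · omega

/-- Since no node has the last one as its parent, the latter is eliminated by shrinking the domain
of its own parent. -/
theorem treeHom_succ_iff (hpar : ∀ j, 1 ≤ j → j ≤ J → par j < j) (hJ : 1 ≤ J)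
    (hD : ∀ j < J, j ≠ par J → ∀ v, D' j v ↔ D j v)
    (hD' : ∀ v, D' (par J) v ↔ D (par J) v ∧ ∃ u, D J u ∧ (A v u ∨ v = u)) :
    TreeHom D A par (J + 1) ↔ TreeHom D' A par J := by
  constructor
  · rintro ⟨φ, hφ, hadj⟩
    refine ⟨φ, fun j hj => ?_, fun j hj hj' => hadj j hj (by omega)⟩
    by_cases h : j = par J
    · subst h
      exact (hD' _).2 ⟨hφ _ (by omega), φ J, hφ J (by omega), hadj J hJ (by omega)⟩
    · exact (hD j hj h _).2 (hφ j (by omega))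
  · rintro ⟨φ, hφ, hadj⟩
    have hp := hpar J hJ le_rfl
    obtain ⟨hv, u, hu, huv⟩ := (hD' _).1 (hφ _ hp)
    refine ⟨Function.update φ J u, fun j hj => ?_, fun j hj hj' => ?_⟩
    · rcases eq_or_ne j J with rfl | hne
      · rwa [Function.update_self]
      · rw [Function.update_of_ne hne]
        by_cases h : j = par J
        · exact h ▸ hv
        · exact (hD j (by omega) h _).1 (hφ j (by omega))
    · have hlt := hpar j hj (by omega)
      rw [Function.update_of_ne (by omega : par j ≠ J)]
      rcases eq_or_ne j J with rfl | hne
      · rwa [Function.update_self]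
      · rw [Function.update_of_ne hne]
        exact hadj j hj (by omega)

end TreeHom

section Slot

variable {V : Type*} [LinearOrder V] (T : Finset V)

/-- The number of elements of `T` below `v`: the position of `v` if `T` is listed in increasing
order from `0`. -/
def rank (v : V) : ℕ := {t ∈ T | t < v}.card

/-- The domain of node `j` in the search: the nodes below `k` range over the non-terminals, and the
node `k + i` is fixed to the `i`-th terminal. -/
def slot (k j : ℕ) (v : V) : Prop := (v ∉ T ∧ j < k) ∨ (v ∈ T ∧ j = k + rank T v)

variable {T}

theorem rank_lt_rank {u v : V} (hu : u ∈ T) (huv : u < v) : rank T u < rank T v := by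
  refine Finset.card_lt_card (Finset.ssubset_iff_of_subset ?_ |>.2 ⟨u, ?_, ?_⟩)
  · exact Finset.monotone_filter_right _ fun t _ ht => lt_trans ht huv
  · exact Finset.mem_filter.2 ⟨hu, huv⟩
  · exact fun h => (Finset.mem_filter.1 h).2.false

theorem rank_injOn : Set.InjOn (rank T) T := by
  intro u hu v hv h
  rcases lt_trichotomy u v with huv | rfl | huv
  · exact absurd h (rank_lt_rank hu huv).ne
  · rfl
  · exact absurd h (rank_lt_rank hv huv).ne'

theorem rank_lt_card {v : V} (hv : v ∈ T) : rank T v < T.card :=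
  Finset.card_lt_card (Finset.filter_ssubset.2 ⟨v, hv, lt_irrefl v⟩)

theorem exists_rank_eq {i : ℕ} (hi : i < T.card) : ∃ v ∈ T, rank T v = i :=
  Finset.surjOn_of_injOn_of_card_le (t := Finset.range T.card) (rank T)
    (fun _ hv => Finset.mem_coe.2 (Finset.mem_range.2 (rank_lt_card hv)))
    rank_injOn (Finset.card_range _).le (Finset.mem_coe.2 (Finset.mem_range.2 hi))

theorem treeHom_slot_of_core {G : SimpleGraph V} {S : Set V} (hfin : S.Finite)
    (hconn : (G.induce S).Connected) {k : ℕ} (hk : S.ncard ≤ k) (hST : ∀ v ∈ S, v ∉ T)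
    (hdom : ∀ t ∈ T, ∃ s ∈ S, G.Adj t s) :
    ∃ par, (∀ j, 1 ≤ j → j < k + T.card → par j < j ∧ par j < k) ∧
      TreeHom (slot T k) G.Adj par (k + T.card) := by
  classical
  obtain ⟨φ, par, hφ, rfl⟩ := exists_isSearchOrder hfin hconn hk
  have : Nonempty V := ⟨φ 0⟩
  choose! term hterm using fun i (hi : i < T.card) => exists_rank_eq hi
  have hdom' : ∀ t ∈ T, ∃ a < k, G.Adj t (φ a) := fun t ht => by
    obtain ⟨_, ⟨a, ha, rfl⟩, hadj⟩ := hdom t ht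
    exact ⟨a, ha, hadj⟩
  choose! att hatt using hdom'
  let ψ : ℕ → V := fun j => if j < k then φ j else term (j - k)
  let par' : ℕ → ℕ := fun j => if j < k then par j else att (term (j - k))
  refine ⟨par', fun j hj hJ => ?_, ψ, fun j hJ => ?_, fun j hj hJ => ?_⟩ <;>
    rcases lt_or_ge j k with hjk | hjk
  · have := (hφ j hj hjk).1
    simp only [par', if_pos hjk]
    omega
  · have := (hatt _ (hterm (j - k) (by omega)).1).1
    simp only [par', if_neg hjk.not_gt]
    omega
  · simp only [ψ, if_pos hjk]
    exact .inl ⟨hST _ ⟨j, hjk, rfl⟩, hjk⟩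
  · obtain ⟨hT, hrank⟩ := hterm (j - k) (by omega)
    simp only [ψ, if_neg hjk.not_gt]
    exact .inr ⟨hT, by omega⟩
  · obtain ⟨hlt, hadj⟩ := hφ j hj hjk
    simpa only [ψ, par', if_pos hjk, if_pos (hlt.trans hjk)] using hadj
  · obtain ⟨hlt, hadj⟩ := hatt _ (hterm (j - k) (by omega)).1
    simp only [ψ, par', if_neg hjk.not_gt, if_pos hlt]
    exact .inl hadj.symm

theorem core_of_treeHom_slot {G : SimpleGraph V} {k : ℕ} (hk : 0 < k) {par : ℕ → ℕ}
    (hpar : ∀ j, 1 ≤ j → j < k + T.card → par j < j ∧ par j < k)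
    (h : TreeHom (slot T k) G.Adj par (k + T.card)) :
    ∃ S : Set V, (G.induce S).Connected ∧ S.ncard ≤ k ∧ (∀ v ∈ S, v ∉ T) ∧
      ∀ t ∈ T, ∃ s ∈ S, G.Adj t s := by
  obtain ⟨φ, hφ, hadj⟩ := h
  have not_mem : ∀ j < k, φ j ∉ T := by
    intro j hj
    rcases hφ j (by omega) with h | h
    · exact h.1
    · omega
  refine ⟨φ '' Set.Iio k, ?_, ?_, ?_, fun t ht => ?_⟩
  · exact IsSearchOrder.connected (par := par)
      (fun j hj hjk => ⟨(hpar j hj (by omega)).1, hadj j hj (by omega)⟩) hk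
  · refine (Set.ncard_image_le (Set.finite_Iio k)).trans ?_
    rw [Set.ncard_eq_toFinset_card', Set.toFinset_Iio, Nat.card_Iio]
  · rintro _ ⟨j, hj, rfl⟩
    exact not_mem j hj
  · have hlt := rank_lt_card ht
    have hpos : 1 ≤ k + rank T t := by omega
    have hp := (hpar _ hpos (by omega)).2
    have hφt : φ (k + rank T t) = t := by
      rcases hφ (k + rank T t) (by omega) with h | h
      · omega
      · exact rank_injOn h.1 ht (by omega)
    refine ⟨_, ⟨par (k + rank T t), hp, rfl⟩, ?_⟩
    rcases hadj _ hpos (by omega) with h | h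
    · rw [hφt] at h
      exact h.symm
    · exact absurd ((h.trans hφt).symm ▸ ht) (not_mem _ hp)

end Slot

section ParentOf

/-- The parent function with code `m`: the base `p` digits of `m`, most significant first, clamped
such that the parent of `j` is below `j` and below `k`. -/
def parentOf (p k m j : ℕ) : ℕ := min (m / p ^ (p - 1 - j) % p) (min (j - 1) (k - 1))

theorem parentOf_lt {p k m j : ℕ} (hk : 0 < k) (hj : 1 ≤ j) :
    parentOf p k m j < j ∧ parentOf p k m j < k := by
  unfold parentOf
  omega

theorem exists_parentOf_eq {p k : ℕ} {par : ℕ → ℕ}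
    (hpar : ∀ j, 1 ≤ j → j < p → par j < j ∧ par j < k) :
    ∃ m < p ^ p, ∀ j, 1 ≤ j → j < p → parentOf p k m j = par j := by
  rcases Nat.eq_zero_or_pos p with rfl | hp
  · exact ⟨0, by simp⟩
  let digits : Fin p → Fin p := fun i => ⟨par (p - 1 - i) % p, Nat.mod_lt _ hp⟩
  refine ⟨finFunctionFinEquiv digits, (finFunctionFinEquiv digits).2, fun j hj hjp => ?_⟩
  obtain ⟨hlt, hlt'⟩ := hpar j hj hjp
  have hdigit : (finFunctionFinEquiv digits : ℕ) / p ^ (p - 1 - j) % p = par j := by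
    have h := congrArg Fin.val
      (congrFun (finFunctionFinEquiv.symm_apply_apply digits) ⟨p - 1 - j, by omega⟩)
    rw [finFunctionFinEquiv_symm_apply_val] at h
    rw [h]
    simp only [digits, show p - 1 - (p - 1 - j) = j by omega]
    exact Nat.mod_eq_of_lt (by omega)
  rw [parentOf, hdigit]
  omega

end ParentOf

namespace TSTInstance

theorem isYes_iff_exists_treeHom (I : TSTInstance) :
    I.IsYes ↔ (I.T.card = 2 ∧ ∃ u ∈ I.T, ∃ v ∈ I.T, I.G.Adj u v) ∨
      ∃ m < I.param ^ I.param,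
        TreeHom (slot I.T I.k) I.G.Adj (parentOf I.param I.k m) I.param := by
  rw [isYes_iff_exists_core]
  refine or_congr_right ⟨?_, ?_⟩
  · rintro ⟨S, hconn, hcard, hST, hdom⟩
    obtain ⟨par, hpar, hhom⟩ := treeHom_slot_of_core S.toFinite hconn hcard hST hdom
    obtain ⟨m, hm, hm'⟩ := exists_parentOf_eq hpar
    exact ⟨m, hm, (treeHom_congr (fun _ _ _ => Iff.rfl) hm').2 hhom⟩
  · rintro ⟨m, -, hhom⟩
    exact core_of_treeHom_slot I.k_pos (fun j hj _ => parentOf_lt I.k_pos hj) hhom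

end TSTInstance

/-! ### Decoding of instances -/

section Bits

/-- The bit at position `i` of a binary string is `1`. -/
def IsOne (x : List Bool) (i : ℕ) : Prop := x[i]? = some true

instance (x : List Bool) : DecidablePred (IsOne x) := fun _ => inferInstanceAs (Decidable (_ = _))

/-- The numerical value of the bit at position `i` of a binary string, and `0` beyond its end. -/
def bit (x : List Bool) (i : ℕ) : ℕ := if x[i]? = some true then 1 else 0

theorem bit_ne_zero {x : List Bool} {i : ℕ} : bit x i ≠ 0 ↔ IsOne x i := by
  unfold bit IsOne
  split_ifs <;> simp_all

theorem IsOne.lt_length {x : List Bool} {i : ℕ} (h : IsOne x i) : i < x.length :=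
  (List.getElem?_eq_some_iff.1 h).1

theorem eq_of_isOne_iff {x y : List Bool} (hlen : x.length = y.length)
    (h : ∀ i < x.length, IsOne x i ↔ IsOne y i) : x = y := by
  refine List.ext_getElem hlen fun i hx hy => Bool.eq_iff_iff.2 ?_
  simpa only [IsOne, List.getElem?_eq_getElem hx, List.getElem?_eq_getElem hy,
    Option.some.injEq] using h i hx

theorem isOne_append_left {x y : List Bool} {i : ℕ} (h : i < x.length) :
    IsOne (x ++ y) i ↔ IsOne x i := by
  rw [IsOne, List.getElem?_append_left h, IsOne]

theorem isOne_append_right {x y : List Bool} {m i : ℕ} (h : x.length = m) :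
    IsOne (x ++ y) (m + i) ↔ IsOne y i := by
  rw [IsOne, List.getElem?_append_right (by omega), IsOne, h, Nat.add_sub_cancel_left]

theorem isOne_ofFn_decide {n : ℕ} {q : Fin n → Prop} [DecidablePred q] (i : Fin n) :
    IsOne (List.ofFn fun j => decide (q j)) i ↔ q i := by
  simp [IsOne]

theorem isOne_flatten_ofFn {m n : ℕ} {q : Fin m → Fin n → Prop} [∀ u v, Decidable (q u v)]
    (u : Fin m) (v : Fin n) :
    IsOne (List.ofFn fun u => List.ofFn fun v => decide (q u v)).flatten (u * n + v) ↔ q u v := by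
  induction m with
  | zero => exact u.elim0
  | succ m ih =>
    rw [List.ofFn_succ, List.flatten_cons]
    cases u using Fin.cases with
    | zero =>
      rw [Fin.val_zero, zero_mul, zero_add, isOne_append_left (by simp)]
      exact isOne_ofFn_decide (q := q 0) v
    | succ u =>
      rw [Fin.val_succ, show (u + 1 : ℕ) * n + v = n + (u * n + v) by ring,
        isOne_append_right (by simp)]
      exact ih u

/-- The value of the last `i` bits of `x`, least significant bit first. -/
def suffixValue (x : List Bool) (i : ℕ) : ℕ :=
  Nat.ofDigits 2 ((x.drop (x.length - i)).map fun b => bif b then 1 else 0)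

theorem suffixValue_zero (x : List Bool) : suffixValue x 0 = 0 := by
  simp [suffixValue]

theorem suffixValue_succ (x : List Bool) {i : ℕ} (hi : i < x.length) :
    suffixValue x (i + 1) = suffixValue x i + suffixValue x i + bit x (x.length - (i + 1)) := by
  have hlt : x.length - (i + 1) < x.length := by omega
  have hs : x.length - (i + 1) + 1 = x.length - i := by omega
  simp only [suffixValue, bit]
  rw [List.drop_eq_getElem_cons hlt, hs, List.map_cons, Nat.ofDigits_cons,
    List.getElem?_eq_getElem hlt]
  cases x[x.length - (i + 1)] <;> simp <;> ring

theorem exists_bits_eq {x : List Bool} (hx : x.getLast? = some true) :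
    ∃ k : ℕ, 0 < k ∧ k.bits = x := by
  let toDigit : Bool → ℕ := fun b => bif b then 1 else 0
  have toDigit_injective : Function.Injective toDigit := by decide
  have hdigits : Nat.digits 2 (Nat.ofDigits 2 (x.map toDigit)) = x.map toDigit := by
    refine Nat.digits_ofDigits 2 one_lt_two _ (fun l hl => ?_) fun hne => ?_
    · obtain ⟨b, _, rfl⟩ := List.mem_map.1 hl
      cases b <;> simp [toDigit]
    · rw [List.getLast?_eq_some_getLast (by simpa using hne), Option.some.injEq] at hx
      simp [hx, toDigit]
  rw [Nat.digits_two_eq_bits] at hdigits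
  have hbits := List.map_injective_iff.2 toDigit_injective hdigits
  refine ⟨_, Nat.pos_of_ne_zero fun h0 => ?_, hbits⟩
  rw [h0, Nat.zero_bits] at hbits
  simp [← hbits] at hx

theorem getLast?_bits {k : ℕ} (hk : 0 < k) : k.bits.getLast? = some true := by
  have hne : k.bits ≠ [] := by
    intro h
    have := Nat.digits_two_eq_bits k
    rw [h, List.map_nil, Nat.digits_eq_nil_iff_eq_zero] at this
    omega
  have hlast := Nat.getLast_digit_ne_zero 2 hk.ne'
  simp only [Nat.digits_two_eq_bits, List.getLast_map] at hlast
  rw [List.getLast?_eq_some_getLast hne]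
  cases h : k.bits.getLast hne <;> simp_all

end Bits

section Decoding

/-- The number of bits before those of `k` in the encoding of an instance with `n` vertices. -/
def headerLength (n : ℕ) : ℕ := n + 1 + n + n * n

/-- The position of the entry `(u, v)` of the adjacency matrix in the encoding of an instance with
`n` vertices. -/
def adjIndex (n u v : ℕ) : ℕ := n + 1 + n + (u * n + v)

theorem adjIndex_lt {n : ℕ} (u v : Fin n) : adjIndex n u v < headerLength n := by
  have : u * n + v < n * n :=
    calc u * n + v < u * n + n := Nat.add_lt_add_left v.2 _
      _ = (u + 1) * n := by ring
      _ ≤ n * n := Nat.mul_le_mul_right _ u.2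
  unfold adjIndex headerLength
  omega

theorem exists_not_isOne (x : List Bool) : ∃ i, ¬ IsOne x i :=
  ⟨x.length, fun h => h.lt_length.false⟩

/-- The number of leading ones, which is the number of vertices if `x` encodes an instance. -/
def codedOrder (x : List Bool) : ℕ := Nat.find (exists_not_isOne x)

theorem codedOrder_le_length (x : List Bool) : codedOrder x ≤ x.length :=
  Nat.find_min' _ fun h => h.lt_length.false

theorem isOne_of_lt_codedOrder {x : List Bool} {i : ℕ} (h : i < codedOrder x) : IsOne x i :=
  not_not.1 (Nat.find_min (exists_not_isOne x) h)

theorem not_isOne_codedOrder (x : List Bool) : ¬ IsOne x (codedOrder x) :=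
  Nat.find_spec (exists_not_isOne x)

/-- The tests by which encodings of instances are recognized: there is room for the header, the
last bit is the leading bit of a positive number, and the adjacency matrix belongs to a simple
graph. -/
def IsCode (x : List Bool) : Prop :=
  headerLength (codedOrder x) < x.length ∧ IsOne x (x.length - 1) ∧
    (∀ u v : Fin (codedOrder x), IsOne x (adjIndex (codedOrder x) u v) →
      IsOne x (adjIndex (codedOrder x) v u)) ∧
    ∀ u : Fin (codedOrder x), ¬ IsOne x (adjIndex (codedOrder x) u u)

end Decoding

namespace TSTInstance

variable (I : TSTInstance)

theorem isOne_encode_of_lt {i : ℕ} (hi : i < I.n) : IsOne I.encode i := by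
  simp only [encode, List.append_assoc]
  rw [isOne_append_left (by simpa)]
  simp [IsOne, hi]

theorem not_isOne_encode_order : ¬ IsOne I.encode I.n := by
  simp only [encode, List.append_assoc]
  refine mt (isOne_append_right (i := 0) List.length_replicate).1 ?_
  simp [IsOne]

theorem isOne_encode_term (v : Fin I.n) : IsOne I.encode (I.n + 1 + v) ↔ v ∈ I.T := by
  classical
  rw [encode, List.append_assoc, List.append_assoc, isOne_append_right (by simp),
    isOne_append_left (by simp)]
  exact isOne_ofFn_decide (q := fun v => v ∈ I.T) v

open Classical in
theorem length_encode_prefix : (List.replicate I.n true ++ [false] ++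
    List.ofFn (fun v : Fin I.n => decide (v ∈ I.T)) ++ (List.ofFn fun u : Fin I.n =>
      List.ofFn fun v : Fin I.n => decide (I.G.Adj u v)).flatten).length = headerLength I.n := by
  simp [headerLength, Function.comp_def]
  ring

theorem isOne_encode_adj (u v : Fin I.n) :
    IsOne I.encode (adjIndex I.n u v) ↔ I.G.Adj u v := by
  classical
  rw [encode, isOne_append_left ((adjIndex_lt u v).trans_eq I.length_encode_prefix.symm), adjIndex,
    isOne_append_right (by simp; omega)]
  exact isOne_flatten_ofFn (q := fun u v => I.G.Adj u v) u v

theorem drop_encode : I.encode.drop (headerLength I.n) = I.k.bits := by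
  rw [encode, List.drop_left' I.length_encode_prefix]

theorem length_encode : I.encode.length = headerLength I.n + I.k.bits.length := by
  rw [encode, List.length_append, length_encode_prefix]

theorem codedOrder_encode : codedOrder I.encode = I.n :=
  (Nat.find_eq_iff _).2
    ⟨I.not_isOne_encode_order, fun _ hi => not_not.2 (I.isOne_encode_of_lt hi)⟩

theorem headerLength_lt_length_encode : headerLength I.n < I.encode.length := by
  rw [length_encode]
  refine Nat.lt_add_of_pos_right (List.length_pos_iff.2 fun h => ?_)
  simpa [h] using getLast?_bits I.k_pos

theorem suffixValue_encode :
    suffixValue I.encode (I.encode.length - headerLength I.n) = I.k := by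
  rw [suffixValue, Nat.sub_sub_self I.headerLength_lt_length_encode.le, drop_encode,
    ← Nat.digits_two_eq_bits, Nat.ofDigits_digits]

theorem isOne_encode_last : IsOne I.encode (I.encode.length - 1) := by
  have hlt := I.headerLength_lt_length_encode
  have hlast := getLast?_bits I.k_pos
  rw [← drop_encode, List.getLast?_drop, if_neg hlt.not_ge] at hlast
  rwa [IsOne, ← List.getLast?_eq_getElem?]

theorem isCode_encode : IsCode I.encode := by
  rw [IsCode, codedOrder_encode]
  simp only [isOne_encode_adj]
  exact ⟨I.headerLength_lt_length_encode, I.isOne_encode_last, fun _ _ h => h.symm,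
    fun u => I.G.irrefl⟩

variable {I}

theorem encode_eq_of_isOne_iff {x : List Bool} (horder : codedOrder x = I.n)
    (hT : ∀ v : Fin I.n, v ∈ I.T ↔ IsOne x (I.n + 1 + v))
    (hadj : ∀ u v : Fin I.n, I.G.Adj u v ↔ IsOne x (adjIndex I.n u v))
    (hlen : headerLength I.n ≤ x.length) (hk : x.drop (headerLength I.n) = I.k.bits) :
    I.encode = x := by
  have hlength : I.encode.length = x.length := by
    rw [length_encode, ← hk, List.length_drop]
    omega
  rw [← List.take_append_drop (headerLength I.n) I.encode,
    ← List.take_append_drop (headerLength I.n) x, drop_encode, hk]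
  congr 1
  refine eq_of_isOne_iff (by simp only [List.length_take, hlength]) fun i hi => ?_
  have hi' : i < headerLength I.n := hi.trans_le (List.length_take_le _ _)
  rw [IsOne, List.getElem?_take_of_lt hi', IsOne, List.getElem?_take_of_lt hi']
  change IsOne I.encode i ↔ IsOne x i
  rcases lt_trichotomy i I.n with h | rfl | h
  · exact iff_of_true (I.isOne_encode_of_lt h) (isOne_of_lt_codedOrder (horder ▸ h))
  · exact iff_of_false I.not_isOne_encode_order (horder ▸ not_isOne_codedOrder x)
  · obtain ⟨w, rfl⟩ := Nat.exists_eq_add_of_le (Nat.succ_le_of_lt h)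
    rw [Nat.succ_eq_add_one]
    rcases lt_or_ge w I.n with hw | hw
    · exact (I.isOne_encode_term ⟨w, hw⟩).trans (hT ⟨w, hw⟩)
    · obtain ⟨w, rfl⟩ := Nat.exists_eq_add_of_le hw
      have hn : 0 < I.n := Nat.pos_of_ne_zero fun h0 => by simp [headerLength, h0] at hi'
      have hlt : w / I.n < I.n := Nat.div_lt_of_lt_mul (by unfold headerLength at hi'; omega)
      have hindex : I.n + 1 + (I.n + w) = adjIndex I.n (w / I.n) (w % I.n) := by
        rw [adjIndex, Nat.div_add_mod', add_assoc (I.n + 1)]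
      rw [hindex]
      exact (I.isOne_encode_adj ⟨_, hlt⟩ ⟨_, Nat.mod_lt w hn⟩).trans (hadj _ _)

end TSTInstance

theorem isCode_iff_exists_encode_eq {x : List Bool} :
    IsCode x ↔ ∃ I : TSTInstance, I.encode = x := by
  refine ⟨fun ⟨hlen, hlast, hsymm, hirrefl⟩ => ?_, fun ⟨I, hI⟩ => hI ▸ I.isCode_encode⟩
  have hdrop : (x.drop (headerLength (codedOrder x))).getLast? = some true := by
    rwa [List.getLast?_drop, if_neg hlen.not_ge, List.getLast?_eq_getElem?]
  obtain ⟨k, hk, hbits⟩ := exists_bits_eq hdrop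
  let I : TSTInstance :=
    { n := codedOrder x
      G :=
        { Adj := fun u v => IsOne x (adjIndex (codedOrder x) u v)
          symm := ⟨hsymm⟩
          loopless := ⟨hirrefl⟩ }
      T := {v | IsOne x (codedOrder x + 1 + v)}
      k := k
      k_pos := hk }
  exact ⟨I, TSTInstance.encode_eq_of_isOne_iff rfl (by simp [I]) (fun _ _ => Iff.rfl) hlen.le
    hbits.symm⟩

/-! ### Programs with counted loops -/

namespace RAM

section Expressions

/-- The values of the variables `ν` of a program, and its memory. -/
structure Env (ν : Type*) where
  /-- the value of each variable -/
  reg : ν → ℕ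
  /-- the memory, shared with the machine -/
  mem : ℕ → ℕ

variable {ν : Type*}

/-- Assignment to a variable. -/
def Env.set [DecidableEq ν] (σ : Env ν) (v : ν) (x : ℕ) : Env ν :=
  { σ with reg := Function.update σ.reg v x }

/-- Assignment to a memory cell. -/
def Env.put (σ : Env ν) (a x : ℕ) : Env ν := { σ with mem := Function.update σ.mem a x }

/-- Arithmetic expressions, with truncated subtraction. -/
inductive Exp (ν : Type*) where
  | var (v : ν) : Exp ν
  | const (c : ℕ) : Exp ν
  | add (a b : Exp ν) : Exp ν
  | sub (a b : Exp ν) : Exp ν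
  | load (a : Exp ν) : Exp ν

namespace Exp

instance : Coe ν (Exp ν) := ⟨var⟩

instance (c : ℕ) : OfNat (Exp ν) c := ⟨const c⟩

instance : Add (Exp ν) := ⟨add⟩

instance : Sub (Exp ν) := ⟨sub⟩

/-- The value of an expression. -/
def eval (σ : Env ν) : Exp ν → ℕ
  | var v => σ.reg v
  | const c => c
  | add a b => a.eval σ + b.eval σ
  | sub a b => a.eval σ - b.eval σ
  | load a => σ.mem (a.eval σ)

/-- The number of steps that the evaluation of an expression takes. -/
def cost : Exp ν → ℕ
  | var _ => 2
  | const _ => 1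
  | add a b => a.cost + b.cost + 1
  | sub a b => a.cost + b.cost + 1
  | load a => a.cost + 1

/-- A program that leaves the value of an expression in register `d`, where the variable `v` lives
in register `ι v` and the registers above `d` are free. -/
def code (ι : ν → ℕ) : Exp ν → ℕ → Prog
  | var v, d => .seq (.const d 0) (.add d d (ι v))
  | const c, d => .const d c
  | add a b, d => .seq (.seq (a.code ι d) (b.code ι (d + 1))) (.add d d (d + 1))
  | sub a b, d => .seq (.seq (a.code ι d) (b.code ι (d + 1))) (.sub d d (d + 1))
  | load a, d => .seq (a.code ι d) (.load d d)

/-- The truth value of `a = b`. -/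
def isEq (a b : Exp ν) : Exp ν := 1 - ((a - b) + (b - a))

/-- The truth value of `a ≠ 0 ∧ b ≠ 0`. -/
def both (a b : Exp ν) : Exp ν := 1 - ((1 - a) + (1 - b))

/-- The minimum of two expressions. -/
def min (a b : Exp ν) : Exp ν := a - (a - b)

section Eval

variable (σ : Env ν) (a b : Exp ν)

/- The parentheses in `(rfl)` keep `simp` from treating these equations as definitional: it would
otherwise leave `Decidable` instances about the unsimplified expressions behind. -/
@[simp] theorem eval_var (v : ν) : (v : Exp ν).eval σ = σ.reg v := (rfl)

@[simp] theorem eval_ofNat (c : ℕ) : (ofNat(c) : Exp ν).eval σ = c := (rfl)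

@[simp] theorem eval_add : (a + b).eval σ = a.eval σ + b.eval σ := (rfl)

@[simp] theorem eval_sub : (a - b).eval σ = a.eval σ - b.eval σ := (rfl)

@[simp] theorem eval_load : a.load.eval σ = σ.mem (a.eval σ) := (rfl)

@[simp] theorem eval_isEq : (a.isEq b).eval σ = if a.eval σ = b.eval σ then 1 else 0 := by
  simp only [isEq, eval_sub, eval_add, eval_ofNat]
  split_ifs <;> omega

@[simp] theorem eval_both :
    (a.both b).eval σ = if a.eval σ ≠ 0 ∧ b.eval σ ≠ 0 then 1 else 0 := by
  simp only [both, eval_sub, eval_add, eval_ofNat]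
  split_ifs <;> omega

@[simp] theorem eval_min : (a.min b).eval σ = Min.min (a.eval σ) (b.eval σ) := by
  simp only [min, eval_sub]
  omega

end Eval

end Exp

/-- The machine state `s` stores the variable `v` in register `ι v`. -/
def Realizes (ι : ν → ℕ) (s : State) (σ : Env ν) : Prop :=
  s.mem = σ.mem ∧ ∀ v, s.reg (ι v) = σ.reg v

variable {ι : ν → ℕ} {d : ℕ}

theorem Realizes.congr {s s' : State} {σ : Env ν} (h : Realizes ι s σ) (hι : ∀ v, ι v < d)
    (hmem : s'.mem = s.mem) (hreg : ∀ r < d, s'.reg r = s.reg r) : Realizes ι s' σ :=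
  ⟨hmem.trans h.1, fun v => (hreg _ (hι v)).trans (h.2 v)⟩

/-- The program `p` leaves the value of `e` in register `d` after `t` steps, and changes neither the
memory nor the registers below `d`. -/
def Computes (ι : ν → ℕ) (d : ℕ) (p : Prog) (e : Exp ν) (t : ℕ) : Prop :=
  ∀ s σ, Realizes ι s σ → ∃ s', Runs p s s' t ∧ s'.mem = s.mem ∧ s'.reg d = e.eval σ ∧
    ∀ r < d, s'.reg r = s.reg r

theorem Computes.seq {p q : Prog} {a b : Exp ν} {t u : ℕ} (hι : ∀ v, ι v < d)
    (hp : Computes ι d p a t) (hq : Computes ι (d + 1) q b u) {s : State} {σ : Env ν}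
    (h : Realizes ι s σ) :
    ∃ s', Runs (.seq p q) s s' (t + u) ∧ s'.mem = s.mem ∧ s'.reg d = a.eval σ ∧
      s'.reg (d + 1) = b.eval σ ∧ ∀ r < d, s'.reg r = s.reg r := by
  obtain ⟨s₁, run₁, mem₁, val₁, reg₁⟩ := hp s σ h
  obtain ⟨s₂, run₂, mem₂, val₂, reg₂⟩ := hq s₁ σ (h.congr hι mem₁ reg₁)
  exact ⟨s₂, .seq run₁ run₂, mem₂.trans mem₁, (reg₂ d d.lt_succ_self).trans val₁, val₂,
    fun r hr => (reg₂ r (hr.trans d.lt_succ_self)).trans (reg₁ r hr)⟩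

theorem State.setReg_reg_self (s : State) (r x : ℕ) : (s.setReg r x).reg r = x :=
  Function.update_self ..

theorem State.setReg_reg_of_ne (s : State) {r r' : ℕ} (x : ℕ) (h : r' ≠ r) :
    (s.setReg r x).reg r' = s.reg r' :=
  Function.update_of_ne h _ _

theorem Exp.computes_code (e : Exp ν) (hι : ∀ v, ι v < d) :
    Computes ι d (e.code ι d) e e.cost := by
  induction e generalizing d with
  | var v =>
    intro s σ h
    refine ⟨_, .seq (.const ..) (.add ..), rfl, ?_, fun r hr => ?_⟩
    · rw [State.setReg_reg_self, State.setReg_reg_self, State.setReg_reg_of_ne _ _ (hι v).ne,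
        zero_add, h.2]
      rfl
    · rw [State.setReg_reg_of_ne _ _ hr.ne, State.setReg_reg_of_ne _ _ hr.ne]
  | const c =>
    intro s σ _
    exact ⟨_, .const .., rfl, State.setReg_reg_self .., fun r hr =>
      State.setReg_reg_of_ne _ _ hr.ne⟩
  | add a b iha ihb =>
    intro s σ h
    obtain ⟨s₁, run, mem, vala, valb, reg⟩ :=
      (iha hι).seq hι (ihb fun v => (hι v).trans d.lt_succ_self) h
    refine ⟨_, .seq run (.add ..), mem, ?_, fun r hr =>
      (State.setReg_reg_of_ne _ _ hr.ne).trans (reg r hr)⟩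
    rw [State.setReg_reg_self, vala, valb]
    rfl
  | sub a b iha ihb =>
    intro s σ h
    obtain ⟨s₁, run, mem, vala, valb, reg⟩ :=
      (iha hι).seq hι (ihb fun v => (hι v).trans d.lt_succ_self) h
    refine ⟨_, .seq run (.sub ..), mem, ?_, fun r hr =>
      (State.setReg_reg_of_ne _ _ hr.ne).trans (reg r hr)⟩
    rw [State.setReg_reg_self, vala, valb]
    rfl
  | load a iha =>
    intro s σ h
    obtain ⟨s₁, run, mem, val, reg⟩ := iha hι s σ h
    refine ⟨_, .seq run (.load ..), mem, ?_, fun r hr =>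
      (State.setReg_reg_of_ne _ _ hr.ne).trans (reg r hr)⟩
    rw [State.setReg_reg_self, val, mem, h.1]
    rfl

end Expressions

section Commands

/-- Structured programs whose only loops are counted. -/
inductive Cmd (ν : Type*) where
  | assign (v : ν) (e : Exp ν) : Cmd ν
  /-- `mem a := e` -/
  | store (a e : Exp ν) : Cmd ν
  | seq (c c' : Cmd ν) : Cmd ν
  /-- repeat `c` for `i = 0, …, b - 1`, with the value that `b` has at the start -/
  | loop (i b : ν) (c : Cmd ν) : Cmd ν

variable {ν : Type*} [DecidableEq ν]

namespace Env

@[simp] theorem set_reg_self (σ : Env ν) (v : ν) (x : ℕ) : (σ.set v x).reg v = x :=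
  Function.update_self ..

@[simp] theorem set_reg_of_ne (σ : Env ν) {v w : ν} (x : ℕ) (h : w ≠ v) :
    (σ.set v x).reg w = σ.reg w :=
  Function.update_of_ne h _ _

@[simp] theorem set_mem (σ : Env ν) (v : ν) (x : ℕ) : (σ.set v x).mem = σ.mem := rfl

omit [DecidableEq ν] in
@[simp] theorem put_reg (σ : Env ν) (a x : ℕ) : (σ.put a x).reg = σ.reg := rfl

omit [DecidableEq ν] in
@[simp] theorem put_mem_self (σ : Env ν) (a x : ℕ) : (σ.put a x).mem a = x :=
  Function.update_self ..

omit [DecidableEq ν] in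
@[simp] theorem put_mem_of_ne (σ : Env ν) {a b : ℕ} (x : ℕ) (h : b ≠ a) :
    (σ.put a x).mem b = σ.mem b :=
  Function.update_of_ne h _ _

end Env

/-- The first `n` rounds of a loop with counter `i` and body `f`. -/
def rounds (f : Env ν → Env ν) (i : ν) : ℕ → Env ν → Env ν
  | 0, σ => σ
  | n + 1, σ => f ((rounds f i n σ).set i n)

theorem rounds_reg_of_ne {f : Env ν → Env ν} {i v : ν}
    (hf : ∀ σ, (f σ).reg v = σ.reg v) (hv : v ≠ i) (n : ℕ) (σ : Env ν) :
    (rounds f i n σ).reg v = σ.reg v := by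
  induction n with
  | zero => rfl
  | succ n ih => exact (hf _).trans ((Env.set_reg_of_ne _ _ hv).trans ih)

namespace Cmd

/-- The effect of a command. -/
def eval : Cmd ν → Env ν → Env ν
  | assign v e, σ => σ.set v (e.eval σ)
  | store a e, σ => σ.put (a.eval σ) (e.eval σ)
  | seq c c', σ => c'.eval (c.eval σ)
  | loop i b c, σ => rounds c.eval i (σ.reg b) σ

section Eval

variable (σ : Env ν)

@[simp] theorem eval_assign (v : ν) (e : Exp ν) : (assign v e).eval σ = σ.set v (e.eval σ) := rfl

@[simp] theorem eval_seq (c c' : Cmd ν) : (seq c c').eval σ = c'.eval (c.eval σ) := rfl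

end Eval

/-- The number of steps that a command takes. -/
def time : Cmd ν → Env ν → ℕ
  | assign _ e, _ => e.cost + 2
  | store a e, _ => a.cost + e.cost + 1
  | seq c c', σ => c.time σ + c'.time (c.eval σ)
  | loop i b c, σ =>
    (∑ j ∈ Finset.range (σ.reg b), (c.time ((rounds c.eval i j σ).set i j) + 5)) + 4

/-- One round of the translated loop with body `p` whose counter lives in register `c`: register `d`
holds the number of remaining rounds, register `d + 1` the number of completed rounds and register
`d + 2` the constant `1`, so that the body may freely change the counter. -/
def roundCode (c d : ℕ) (p : Prog) : Prog :=
  .seq (.seq (.const c 0) (.add c c (d + 1))) <| .seq p <|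
    .seq (.sub d d (d + 2)) (.add (d + 1) (d + 1) (d + 2))

/-- The translation of a command, where the variable `v` lives in register `ι v` and the registers
above `d` are free. -/
def code (ι : ν → ℕ) : Cmd ν → ℕ → Prog
  | assign v e, d => .seq (e.code ι d) (.seq (.const (ι v) 0) (.add (ι v) (ι v) d))
  | store a e, d => .seq (.seq (a.code ι d) (e.code ι (d + 1))) (.store d (d + 1))
  | seq c c', d => .seq (c.code ι d) (c'.code ι d)
  | loop i b c, d =>
    .seq (.seq (.seq (.const (d + 1) 0) (.add d (d + 1) (ι b))) (.const (d + 2) 1)) <|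
    .loop d (roundCode (ι i) d (c.code ι (d + 3)))

end Cmd

variable {ι : ν → ℕ} {d : ℕ}

theorem Realizes.setReg {s : State} {σ : Env ν} (h : Realizes ι s σ) (hι : Function.Injective ι)
    (v : ν) (x : ℕ) : Realizes ι (s.setReg (ι v) x) (σ.set v x) :=
  ⟨h.1, fun w => by
    simp only [State.setReg, Env.set, Function.update_apply, hι.eq_iff, h.2 w]⟩

theorem runs_copy (s : State) {v d : ℕ} (h : v ≠ d) :
    Runs (.seq (.const v 0) (.add v v d)) s (s.setReg v (s.reg d)) 2 := by
  have hs : ((s.setReg v 0).setReg v ((s.setReg v 0).reg v + (s.setReg v 0).reg d)) =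
      s.setReg v (s.reg d) := by
    rw [State.setReg_reg_self, State.setReg_reg_of_ne _ _ h.symm, zero_add]
    simp only [State.setReg, Function.update_idem]
  exact hs ▸ .seq (.const ..) (.add ..)

/-- The program `p` takes a state that realizes `σ` to one that realizes `τ` in `t` steps, and
changes no register below `d` but those of the variables. -/
def Implements (ι : ν → ℕ) (d : ℕ) (p : Prog) (σ τ : Env ν) (t : ℕ) : Prop :=
  ∀ s, Realizes ι s σ → ∃ s', Runs p s s' t ∧ Realizes ι s' τ ∧
    ∀ r < d, r ∉ Set.range ι → s'.reg r = s.reg r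

theorem implements_assign (hι : Function.Injective ι) (hd : ∀ v, ι v < d) (v : ν) (e : Exp ν)
    (σ : Env ν) : Implements ι d ((Cmd.assign v e).code ι d) σ (σ.set v (e.eval σ))
      (e.cost + 2) := by
  intro s h
  obtain ⟨s₁, run, mem, val, reg⟩ := e.computes_code hd s σ h
  refine ⟨_, .seq run (runs_copy s₁ (hd v).ne), ?_, fun r hr hrι => ?_⟩
  · exact val ▸ (h.congr hd mem reg).setReg hι v _
  · exact (State.setReg_reg_of_ne _ _ fun h => hrι ⟨v, h.symm⟩).trans (reg r hr)

omit [DecidableEq ν] in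
theorem implements_store (hd : ∀ v, ι v < d) (a e : Exp ν) (σ : Env ν) :
    Implements ι d ((Cmd.store a e).code ι d) σ (σ.put (a.eval σ) (e.eval σ))
      (a.cost + e.cost + 1) := by
  intro s h
  obtain ⟨s₁, run, mem, vala, vale, reg⟩ := (a.computes_code hd).seq hd
    (e.computes_code fun v => (hd v).trans d.lt_succ_self) h
  refine ⟨_, .seq run (.store ..), ⟨?_, fun v => ?_⟩, fun r hr _ => reg r hr⟩
  · simp only [State.setMem, Env.put, mem, h.1, vala, vale]
  · exact (reg _ (hd v)).trans (h.2 v)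

omit [DecidableEq ν] in
theorem notMem_range_of_le (hd : ∀ v, ι v < d) {r : ℕ} (hr : d ≤ r) : r ∉ Set.range ι := by
  rintro ⟨v, rfl⟩
  exact absurd (hd v) hr.not_gt

theorem exists_runs_roundCode {p : Prog} {f : Env ν → Env ν} {t : Env ν → ℕ}
    (hι : Function.Injective ι) (hd : ∀ v, ι v < d)
    (hp : ∀ σ, Implements ι (d + 3) p σ (f σ) (t σ)) (i : ν) {m j : ℕ} {s : State} {σ : Env ν}
    (h : Realizes ι s σ) (hm : s.reg d = m + 1) (hj : s.reg (d + 1) = j)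
    (h1 : s.reg (d + 2) = 1) :
    ∃ s', Runs (Cmd.roundCode (ι i) d p) s s' (t (σ.set i j) + 4) ∧
      Realizes ι s' (f (σ.set i j)) ∧ s'.reg d = m ∧ s'.reg (d + 1) = j + 1 ∧
      s'.reg (d + 2) = 1 ∧ ∀ r < d, r ∉ Set.range ι → s'.reg r = s.reg r := by
  have run₁ := runs_copy s (v := ι i) (d := d + 1) ((hd i).trans d.lt_succ_self).ne
  obtain ⟨s₂, run₂, h₂, reg₂⟩ := hp _ _ (h.setReg hι i (s.reg (d + 1)))
  replace reg₂ (r : ℕ) (hr : r < d + 3) (hrι : r ∉ Set.range ι) : s₂.reg r = s.reg r :=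
    (reg₂ r hr hrι).trans (State.setReg_reg_of_ne _ _ fun h => hrι ⟨i, h.symm⟩)
  have reg_d := (reg₂ d (by omega) (notMem_range_of_le hd le_rfl)).trans hm
  have reg_d1 := (reg₂ (d + 1) (by omega) (notMem_range_of_le hd (by omega))).trans hj
  have reg_d2 := (reg₂ (d + 2) (by omega) (notMem_range_of_le hd (by omega))).trans h1
  have run := Runs.seq run₁ (.seq run₂
    (.seq (.sub d d (d + 2) s₂) (.add (d + 1) (d + 1) (d + 2) _)))
  rw [hj] at run h₂
  rw [show 2 + (t (σ.set i j) + (1 + 1)) = t (σ.set i j) + 4 by omega] at run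
  refine ⟨_, run, h₂.congr hd rfl fun r hr => ?_, ?_, ?_, ?_, fun r hr hrι => ?_⟩
  · rw [State.setReg_reg_of_ne _ _ (by omega), State.setReg_reg_of_ne _ _ (by omega)]
  · rw [State.setReg_reg_of_ne _ _ (by omega), State.setReg_reg_self, reg_d, reg_d2]
    rfl
  · rw [State.setReg_reg_self, State.setReg_reg_of_ne _ _ (by omega),
      State.setReg_reg_of_ne _ _ (by omega), reg_d1, reg_d2]
  · rw [State.setReg_reg_of_ne _ _ (by omega), State.setReg_reg_of_ne _ _ (by omega), reg_d2]
  · rw [State.setReg_reg_of_ne _ _ (by omega), State.setReg_reg_of_ne _ _ (by omega)]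
    exact reg₂ r (by omega) hrι

theorem exists_runs_loop_roundCode {p : Prog} {f : Env ν → Env ν} {t : Env ν → ℕ}
    (hι : Function.Injective ι) (hd : ∀ v, ι v < d)
    (hp : ∀ σ, Implements ι (d + 3) p σ (f σ) (t σ)) (i : ν) (σ : Env ν) (m : ℕ) :
    ∀ j s, Realizes ι s (rounds f i j σ) → s.reg d = m → s.reg (d + 1) = j →
      s.reg (d + 2) = 1 →
      ∃ s', Runs (.loop d (Cmd.roundCode (ι i) d p)) s s'
          ((∑ l ∈ Finset.range m, (t ((rounds f i (j + l) σ).set i (j + l)) + 5)) + 1) ∧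
        Realizes ι s' (rounds f i (j + m) σ) ∧
        ∀ r < d, r ∉ Set.range ι → s'.reg r = s.reg r := by
  induction m with
  | zero =>
    intro j s h h0 _ _
    exact ⟨s, .loopDone h0, h, fun _ _ _ => rfl⟩
  | succ m ih =>
    intro j s h hm hj h1
    obtain ⟨s₁, run₁, h₁, hm₁, hj₁, h1₁, reg₁⟩ :=
      exists_runs_roundCode hι hd hp i h hm hj h1
    obtain ⟨s₂, run₂, h₂, reg₂⟩ := ih (j + 1) s₁ h₁ hm₁ hj₁ h1₁
    refine ⟨s₂, ?_, (add_right_comm j 1 m ▸ h₂ :), fun r hr hrι =>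
      (reg₂ r hr hrι).trans (reg₁ r hr hrι)⟩
    convert Runs.loopStep (hm ▸ m.succ_ne_zero) run₁ run₂ using 1
    simp only [Finset.sum_range_succ', add_zero, add_assoc, add_comm 1]
    omega

theorem exists_runs_loopInit (s : State) {b d : ℕ} (hb : b < d) :
    ∃ s', Runs (.seq (.seq (.const (d + 1) 0) (.add d (d + 1) b)) (.const (d + 2) 1)) s s' 3 ∧
      s'.mem = s.mem ∧ s'.reg d = s.reg b ∧ s'.reg (d + 1) = 0 ∧ s'.reg (d + 2) = 1 ∧
      ∀ r < d, s'.reg r = s.reg r := by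
  refine ⟨_, .seq (.seq (.const ..) (.add ..)) (.const ..), rfl, ?_, ?_,
    State.setReg_reg_self .., fun r hr => ?_⟩
  · rw [State.setReg_reg_of_ne _ _ (by omega), State.setReg_reg_self, State.setReg_reg_self,
      State.setReg_reg_of_ne _ _ (by omega), zero_add]
  · rw [State.setReg_reg_of_ne _ _ (by omega), State.setReg_reg_of_ne _ _ (by omega),
      State.setReg_reg_self]
  · rw [State.setReg_reg_of_ne _ _ (by omega), State.setReg_reg_of_ne _ _ (by omega),
      State.setReg_reg_of_ne _ _ (by omega)]

theorem Cmd.implements_code (c : Cmd ν) (hι : Function.Injective ι) (hd : ∀ v, ι v < d)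
    (σ : Env ν) : Implements ι d (c.code ι d) σ (c.eval σ) (c.time σ) := by
  induction c generalizing d σ with
  | assign v e => exact implements_assign hι hd v e σ
  | store a e => exact implements_store hd a e σ
  | seq c c' ih ih' =>
    intro s h
    obtain ⟨s₁, run₁, h₁, reg₁⟩ := ih hd σ s h
    obtain ⟨s₂, run₂, h₂, reg₂⟩ := ih' hd _ s₁ h₁
    exact ⟨s₂, .seq run₁ run₂, h₂, fun r hr hrι => (reg₂ r hr hrι).trans (reg₁ r hr hrι)⟩
  | loop i b c ih =>
    intro s h
    obtain ⟨s₁, run₁, mem₁, hm₁, hj₁, h1₁, reg₁⟩ := exists_runs_loopInit s (hd b)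
    obtain ⟨s₂, run₂, h₂, reg₂⟩ := exists_runs_loop_roundCode hι hd
      (ih fun v => (hd v).trans (by omega)) i σ (σ.reg b) 0 s₁ (h.congr hd mem₁ reg₁)
      (hm₁.trans (h.2 b)) hj₁ h1₁
    rw [zero_add] at h₂
    refine ⟨s₂, ?_, h₂, fun r hr hrι => (reg₂ r hr hrι).trans (reg₁ r hr)⟩
    simp only [zero_add] at run₂
    have run := Runs.seq run₁ run₂
    rwa [add_comm 3, add_assoc] at run

end Commands

end RAM

theorem mul_pow_add_mul_pow_le {a : ℕ} (ha : 0 < a) (C C' d d' : ℕ) :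
    C * a ^ d + C' * a ^ d' ≤ (C + C') * a ^ (d + d') := by
  rw [add_mul]
  gcongr <;> omega

namespace RAM.Cmd

variable {ν : Type*}

/-- The variables to which a command may assign. -/
def writes : Cmd ν → List ν
  | assign v _ => [v]
  | store _ _ => []
  | seq c c' => c.writes ++ c'.writes
  | loop i _ c => i :: c.writes

/-- The command does not change the memory. -/
def StoreFree : Cmd ν → Prop
  | assign _ _ => True
  | store _ _ => False
  | seq c c' => c.StoreFree ∧ c'.StoreFree
  | loop _ _ c => c.StoreFree

/-- The command changes only memory cells whose address is at least the value of `v`. -/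
def StoresFrom (v : ν) : Cmd ν → Prop
  | assign _ _ => True
  | store a _ => ∃ e, a = v + e
  | seq c c' => c.StoresFrom v ∧ c'.StoresFrom v
  | loop _ _ c => c.StoresFrom v

/-- The variables that bound the loops of a command. -/
def loopBounds : Cmd ν → List ν
  | assign _ _ => []
  | store _ _ => []
  | seq c c' => c.loopBounds ++ c'.loopBounds
  | loop _ b c => b :: c.loopBounds

theorem StoreFree.storesFrom {c : Cmd ν} (hc : c.StoreFree) (v : ν) : c.StoresFrom v := by
  induction c with
  | assign w e => trivial
  | store a e => exact hc.elim
  | seq c c' ih ih' => exact ⟨ih hc.1, ih' hc.2⟩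
  | loop i b c ih => exact ih hc

variable [DecidableEq ν]

theorem eval_reg_of_notMem_writes (c : Cmd ν) {v : ν} (hv : v ∉ c.writes) (σ : Env ν) :
    (c.eval σ).reg v = σ.reg v := by
  induction c generalizing σ with
  | assign w e => exact Env.set_reg_of_ne _ _ (by simpa only [writes, List.mem_singleton] using hv)
  | store a e => rfl
  | seq c c' ih ih' =>
    simp only [writes, List.mem_append, not_or] at hv
    exact (ih' hv.2 _).trans (ih hv.1 σ)
  | loop i b c ih =>
    simp only [writes, List.mem_cons, not_or] at hv
    exact rounds_reg_of_ne (ih hv.2) hv.1 _ σ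

theorem StoreFree.eval_mem {c : Cmd ν} (hc : c.StoreFree) (σ : Env ν) :
    (c.eval σ).mem = σ.mem := by
  induction c generalizing σ with
  | assign v e => rfl
  | store a e => exact hc.elim
  | seq c c' ih ih' => exact (ih' hc.2 _).trans (ih hc.1 σ)
  | loop i b c ih =>
    change (rounds c.eval i (σ.reg b) σ).mem = _
    induction σ.reg b with
    | zero => rfl
    | succ n ihn => exact (ih hc _).trans ihn

theorem StoresFrom.eval_mem_of_lt {c : Cmd ν} {v : ν} (hc : c.StoresFrom v) (hv : v ∉ c.writes)
    {σ : Env ν} {a : ℕ} (ha : a < σ.reg v) : (c.eval σ).mem a = σ.mem a := by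
  induction c generalizing σ with
  | assign w e => rfl
  | store b e =>
    obtain ⟨b, rfl⟩ := hc
    exact Function.update_of_ne (ha.trans_le (Nat.le_add_right _ (b.eval σ))).ne _ _
  | seq c c' ih ih' =>
    simp only [writes, List.mem_append, not_or] at hv
    refine (ih' hc.2 hv.2 ?_).trans (ih hc.1 hv.1 ha)
    rwa [c.eval_reg_of_notMem_writes hv.1]
  | loop i b c ih =>
    simp only [writes, List.mem_cons, not_or] at hv
    change (rounds c.eval i (σ.reg b) σ).mem a = _
    induction σ.reg b with
    | zero => rfl
    | succ n ihn =>
      refine (ih hc hv.2 ?_).trans ihn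
      rwa [Env.set_reg_of_ne _ _ hv.1, rounds_reg_of_ne (c.eval_reg_of_notMem_writes hv.2) hv.1]

theorem loop_induction {i b : ν} {c : Cmd ν} {σ : Env ν} {P : ℕ → Env ν → Prop} (zero : P 0 σ)
    (succ : ∀ j < σ.reg b, ∀ τ, (∀ v ∉ (loop i b c).writes, τ.reg v = σ.reg v) → P j τ →
      P (j + 1) (c.eval (τ.set i j))) :
    P (σ.reg b) ((loop i b c).eval σ) := by
  have invariant (n : ℕ) (hn : n ≤ σ.reg b) : P n (rounds c.eval i n σ) := by
    induction n with
    | zero => exact zero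
    | succ n ih =>
      refine succ n hn _ (fun v hv => ?_) (ih (by omega))
      simp only [writes, List.mem_cons, not_or] at hv
      exact rounds_reg_of_ne (c.eval_reg_of_notMem_writes hv.2) hv.1 n σ
  exact invariant _ le_rfl

theorem loop_sum {i b acc : ν} {c : Cmd ν} {σ : Env ν} {f : ℕ → ℕ} (hc : c.StoreFree)
    (hacc : acc ≠ i)
    (hf : ∀ j < σ.reg b, ∀ τ, (∀ v ∉ (loop i b c).writes, τ.reg v = σ.reg v) → τ.mem = σ.mem →
      τ.reg i = j → (c.eval τ).reg acc = τ.reg acc + f j) :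
    ((loop i b c).eval σ).reg acc = σ.reg acc + ∑ j ∈ Finset.range (σ.reg b), f j := by
  refine (loop_induction (P := fun j τ => τ.mem = σ.mem ∧
    τ.reg acc = σ.reg acc + ∑ j ∈ Finset.range j, f j) ⟨rfl, rfl⟩ ?_).2
  rintro j hj τ agree ⟨mem, val⟩
  refine ⟨(hc.eval_mem _).trans mem, ?_⟩
  rw [hf j hj (τ.set i j) (fun v hv => ?_) mem (Env.set_reg_self ..), Finset.sum_range_succ,
    ← add_assoc, ← val, Env.set_reg_of_ne _ _ hacc]
  exact (Env.set_reg_of_ne _ _ (by rintro rfl; exact hv List.mem_cons_self)).trans (agree v hv)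

theorem exists_time_le (c : Cmd ν) (hc : ∀ b ∈ c.loopBounds, b ∉ c.writes) :
    ∃ C d, ∀ M σ, (∀ b ∈ c.loopBounds, σ.reg b ≤ M) → c.time σ ≤ C * (M + 1) ^ d := by
  induction c with
  | assign v e => exact ⟨e.cost + 2, 0, fun M σ _ => by simp [time]⟩
  | store a e => exact ⟨a.cost + e.cost + 1, 0, fun M σ _ => by simp [time]⟩
  | seq c c' ih ih' =>
    simp only [loopBounds, writes, List.mem_append, not_or] at hc ⊢
    obtain ⟨C, d, hC⟩ := ih fun b hb => (hc b (.inl hb)).1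
    obtain ⟨C', d', hC'⟩ := ih' fun b hb => (hc b (.inr hb)).2
    refine ⟨C + C', d + d', fun M σ hM => ?_⟩
    have le := hC M σ fun b hb => hM b (.inl hb)
    have le' := hC' M (c.eval σ) fun b hb =>
      (c.eval_reg_of_notMem_writes (hc b (.inr hb)).1 σ).trans_le (hM b (.inr hb))
    exact (add_le_add le le').trans (mul_pow_add_mul_pow_le M.succ_pos ..)
  | loop i b c ih =>
    simp only [loopBounds, writes, List.mem_cons, not_or] at hc ⊢
    obtain ⟨C, d, hC⟩ := ih fun b hb => (hc b (.inr hb)).2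
    refine ⟨C + 9, d + 1, fun M σ hM => ?_⟩
    have round (j : ℕ) : c.time ((rounds c.eval i j σ).set i j) ≤ C * (M + 1) ^ d :=
      hC M _ fun v hv => by
        rw [Env.set_reg_of_ne _ _ (hc v (.inr hv)).1, rounds_reg_of_ne
          (c.eval_reg_of_notMem_writes (hc v (.inr hv)).2) (hc v (.inr hv)).1]
        exact hM v (.inr hv)
    calc (∑ j ∈ Finset.range (σ.reg b), (c.time ((rounds c.eval i j σ).set i j) + 5)) + 4
        ≤ (∑ _j ∈ Finset.range (σ.reg b), (C * (M + 1) ^ d + 5)) + 4 := by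
          gcongr with j _
          exact round j
      _ = σ.reg b * (C * (M + 1) ^ d + 5) + 4 := by simp
      _ ≤ M * (C * (M + 1) ^ d + 5) + 4 := by gcongr; exact hM b (.inl rfl)
      _ ≤ (C + 9) * (M + 1) ^ (d + 1) := by
          have : 1 ≤ (M + 1) ^ d := Nat.one_le_pow _ _ M.succ_pos
          rw [pow_succ]
          nlinarith

/-- Assignment of a product. -/
def mul (i acc a b : ν) : Cmd ν := .seq (.assign acc 0) (.loop i a (.assign acc (acc + b)))

@[simp] theorem eval_mul {i acc a b : ν} (hi : acc ≠ i) (ha : a ≠ acc) (hb : b ≠ acc)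
    (hbi : b ≠ i) (σ : Env ν) : ((mul i acc a b).eval σ).reg acc = σ.reg a * σ.reg b := by
  refine (loop_sum (c := .assign acc (acc + b)) (f := fun _ => σ.reg b) trivial hi
    fun j _ τ agree _ _ => ?_).trans ?_
  · rw [← Env.set_reg_of_ne σ 0 hb]
    exact (Env.set_reg_self ..).trans (congrArg _ (agree b (by simp [writes, hb, hbi])))
  · simp [ha]

@[simp] theorem eval_mul_reg_of_ne {i acc a b v : ν} (hi : v ≠ i) (hacc : v ≠ acc) (σ : Env ν) :
    ((mul i acc a b).eval σ).reg v = σ.reg v :=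
  eval_reg_of_notMem_writes _ (by simp [mul, writes, hi, hacc]) σ

@[simp] theorem eval_mul_mem (i acc a b : ν) (σ : Env ν) :
    ((mul i acc a b).eval σ).mem = σ.mem :=
  StoreFree.eval_mem (c := mul i acc a b) (by simp [mul, StoreFree]) σ

end RAM.Cmd

/-! ### The program for Terminal Steiner Tree -/

namespace TSTSolver

open RAM Finset

infix:55 "≔" => Cmd.assign
infixr:50 ";;" => Cmd.seq

/-- The variables of the program. -/
inductive Var where
  | len | param | order | square | numBits | edges | power | bound | budget | numT | bad | ans
  | ix | row | col | rowOff | colOff | tree | quot | newQuot | multiple | digit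
  | edge | node | nodeOff | parent | parentOff | seen | flag
  deriving DecidableEq

open Var

/-- Computes the order `n` of the graph, which is the length of the initial block of ones. -/
def readOrder : Cmd Var :=
  order ≔ 0 ;; .loop ix len (order ≔ order + .both (.isEq order ix) (.load ix))

/-- Computes the number `p ^ p` of candidate trees, where `p` is the parameter. -/
def computeBound : Cmd Var :=
  bound ≔ 1 ;; .loop col param (.mul ix power param bound ;; bound ≔ power)

/-- Computes the values on which the running times of the later loops depend. -/
def layout : Cmd Var :=
  .mul ix square order order ;;
  numBits ≔ len - (order + 1 + order + square) ;;
  edges ≔ param - 1 ;;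
  computeBound

/-- The environment at the start, on input `(x, p)`. -/
structure Input (x : List Bool) (p : ℕ) (σ : Env Var) : Prop where
  len : σ.reg len = x.length
  param : σ.reg param = p
  mem : ∀ i, σ.mem i = bit x i

/-- The environment after the computation of the loop bounds, on input `(x, p)`. -/
structure Parsed (x : List Bool) (p : ℕ) (σ : Env Var) : Prop extends Input x p σ where
  order : σ.reg order = codedOrder x
  numBits : σ.reg numBits = x.length - headerLength (codedOrder x)
  edges : σ.reg edges = p - 1
  bound : σ.reg bound = p ^ p

section LoopBounds

variable {x : List Bool} {p : ℕ} {σ : Env Var}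

theorem eval_readOrder_reg_order (h : Input x p σ) :
    (readOrder.eval σ).reg order = codedOrder x := by
  refine (Cmd.loop_induction (i := ix) (b := len) (σ := σ.set order 0) (P := fun j τ =>
    τ.mem = σ.mem ∧ τ.reg order = min j (codedOrder x)) ⟨rfl, by simp [Env.set]⟩ ?_).2.trans
      (min_eq_right ((codedOrder_le_length x).trans_eq h.len.symm))
  rintro j - τ - ⟨mem, val⟩
  suffices min j (codedOrder x) + (if min j (codedOrder x) = j ∧ IsOne x j then 1 else 0) =
      min (j + 1) (codedOrder x) from ⟨mem, by simpa [val, mem, h.mem, bit_ne_zero] using this⟩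
  rcases lt_trichotomy j (codedOrder x) with hj | rfl | hj
  · simp [hj.le, isOne_of_lt_codedOrder hj, Nat.succ_le_of_lt hj]
  · simp [not_isOne_codedOrder]
  · simp [hj.le, hj.ne, hj.le.trans j.le_succ]

@[simp] theorem eval_computeBound_reg_bound (σ : Env Var) :
    (computeBound.eval σ).reg bound = σ.reg param ^ σ.reg param := by
  refine Cmd.loop_induction (i := col) (b := param) (σ := σ.set bound 1)
    (P := fun j τ => τ.reg bound = σ.reg param ^ j) (by simp) fun j _ τ agree val => ?_
  have hparam : τ.reg param = σ.reg param := agree _ (by decide)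
  simp [hparam, val, pow_succ']

theorem parsed_layout (h : Input x p σ) (horder : σ.reg order = codedOrder x) :
    Parsed x p (layout.eval σ) where
  len := (layout.eval_reg_of_notMem_writes (by decide) σ).trans h.len
  param := (layout.eval_reg_of_notMem_writes (by decide) σ).trans h.param
  mem i := by
    rw [Cmd.StoreFree.eval_mem (by simp [layout, computeBound, Cmd.mul, Cmd.StoreFree]), h.mem]
  order := (layout.eval_reg_of_notMem_writes (by decide) σ).trans horder
  numBits := by
    simp (disch := decide) [layout, Cmd.eval_reg_of_notMem_writes, h.len, horder, headerLength]
  edges := by simp (disch := decide) [layout, Cmd.eval_reg_of_notMem_writes, h.param]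
  bound := by simp [layout, h.param]

end LoopBounds

section Readers

/-- The entry `v` of the characteristic vector of the terminals. -/
def term (v : Var) : Exp Var := .load (order + 1 + v)

/-- The entry `(u, v)` of the adjacency matrix, where the value of `off` is `n * u`. -/
def adj (off v : Var) : Exp Var := .load (order + 1 + order + (off + v))

/-- Adds up the values of `e` over all pairs `(row, col)` of vertices. -/
def forPairs (acc : Var) (e : Exp Var) : Cmd Var :=
  .loop row order (.mul ix rowOff order row ;;
    .loop col order (.mul ix colOff order col ;; acc ≔ acc + e))

/-- Computes the number of terminals. -/
def readTerminals : Cmd Var := numT ≔ 0 ;; .loop ix order (numT ≔ numT + term ix)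

/-- Computes the number encoded by the bits after the adjacency matrix. -/
def readBudget : Cmd Var :=
  budget ≔ 0 ;; .loop ix numBits (budget ≔ budget + budget + .load (len - (ix + 1)))

/-- Increases `bad` if the adjacency matrix is not that of a simple graph. -/
def checkGraph : Cmd Var :=
  forPairs bad ((adj rowOff col - adj colOff row) + .both (adj rowOff col) (.isEq row col))

/-- Computes a number that is `0` if and only if the input encodes an instance with the given
parameter. -/
def validate : Cmd Var :=
  bad ≔ (1 - numBits) + (1 - .load (len - 1)) +
    ((budget + numT - param) + (param - (budget + numT))) ;;
  checkGraph

variable {x : List Bool} {p : ℕ} {σ : Env Var}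

theorem eval_term (v : Var) (σ : Env Var) :
    (term v).eval σ = σ.mem (σ.reg order + 1 + σ.reg v) := rfl

theorem eval_adj {off v : Var} {σ : Env Var} {u : ℕ} (h : σ.reg off = σ.reg order * u) :
    (adj off v).eval σ = σ.mem (adjIndex (σ.reg order) u (σ.reg v)) := by
  rw [adjIndex, mul_comm u, ← h]
  rfl

theorem eval_forPairs {acc : Var} {e : Exp Var} {f : ℕ → ℕ → ℕ}
    (hacc : acc ∉ [order, row, col, rowOff, colOff, ix])
    (he : ∀ τ : Env Var, τ.mem = σ.mem →
      (∀ v ∉ [acc, row, col, rowOff, colOff, ix], τ.reg v = σ.reg v) →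
      (∀ v, (adj rowOff v).eval τ = σ.mem (adjIndex (σ.reg order) (τ.reg row) (τ.reg v))) →
      (∀ v, (adj colOff v).eval τ = σ.mem (adjIndex (σ.reg order) (τ.reg col) (τ.reg v))) →
      e.eval τ = f (τ.reg row) (τ.reg col)) :
    ((forPairs acc e).eval σ).reg acc = σ.reg acc +
      ∑ u ∈ range (σ.reg order), ∑ v ∈ range (σ.reg order), f u v := by
  simp only [List.mem_cons, List.not_mem_nil, or_false, not_or] at hacc
  obtain ⟨hn, hr, hc, hro, hco, hi⟩ := hacc
  refine Cmd.loop_sum (by simp [Cmd.mul, Cmd.StoreFree]) hr fun u _ τ agree mem hu => ?_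
  have inputs : ∀ v ∉ [acc, row, col, rowOff, colOff, ix], τ.reg v = σ.reg v := fun v hv =>
    agree v (by simpa [Cmd.mul, Cmd.writes, and_assoc, and_comm, and_left_comm] using hv)
  have hτn : τ.reg order = σ.reg order := inputs _ (by simp [Ne.symm hn])
  refine (Cmd.loop_sum (f := f u) (by simp [Cmd.mul, Cmd.StoreFree]) hc
    fun v _ τ' agree' mem' hv => ?_).trans (by simp [hro, hi, hτn])
  have reg' : ∀ v ∉ [acc, col, colOff, ix],
      τ'.reg v = ((Cmd.mul ix rowOff order row).eval τ).reg v := fun v hv =>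
    agree' v (by simpa [Cmd.mul, Cmd.writes, and_assoc, and_comm, and_left_comm] using hv)
  have hr' : τ'.reg row = u := (reg' _ (by simp [Ne.symm hr])).trans (by simp [hu])
  have hn' : τ'.reg order = σ.reg order := (reg' _ (by simp [Ne.symm hn])).trans (by simp [hτn])
  have hro' : τ'.reg rowOff = σ.reg order * u :=
    (reg' _ (by simp [Ne.symm hro])).trans (by simp [hτn, hu])
  have value := he ((Cmd.mul ix colOff order col).eval τ') (by simp [mem', mem]) (fun w hw => by
    simp only [List.mem_cons, List.not_mem_nil, or_false, not_or] at hw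
    simp [hw, reg', inputs]) (fun w => by
      rw [eval_adj (u := u)] <;> simp [hr', hn', hro', mem', mem]) (fun w => by
      rw [eval_adj (u := v)] <;> simp [hn', hv, mem', mem])
  simp [hco, hi, value, hr', hv]

theorem eval_readTerminals (h : Parsed x p σ) : (readTerminals.eval σ).reg numT =
    ∑ v ∈ range (codedOrder x), bit x (codedOrder x + 1 + v) := by
  refine (Cmd.loop_sum (f := fun v => bit x (codedOrder x + 1 + v)) (by simp [Cmd.StoreFree])
    (by decide) fun v _ τ agree mem hv => ?_).trans (by simp [h.order])
  simp (disch := decide) [eval_term, mem, h.mem, agree, h.order, hv]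

theorem eval_readBudget (h : Parsed x p σ) : (readBudget.eval σ).reg budget =
    suffixValue x (x.length - headerLength (codedOrder x)) := by
  rw [← h.numBits]
  refine (Cmd.loop_induction (i := ix) (b := numBits) (σ := σ.set budget 0) (P := fun j τ =>
    τ.mem = σ.mem ∧ τ.reg budget = suffixValue x j) ⟨rfl, by simp [suffixValue_zero]⟩ ?_).2
  rintro j hj τ agree ⟨mem, val⟩
  have hj' : j < x.length := by
    rw [Env.set_reg_of_ne _ _ (by decide), h.numBits] at hj
    omega
  refine ⟨mem, ?_⟩
  simp (disch := decide) [suffixValue_succ x hj', val, mem, h.mem, agree, h.len]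

theorem bit_sub_bit_eq_zero {i j : ℕ} : bit x i - bit x j = 0 ↔ (IsOne x i → IsOne x j) := by
  simp only [bit, IsOne]
  split_ifs <;> simp_all

theorem one_sub_bit_eq_zero {i : ℕ} : 1 - bit x i = 0 ↔ IsOne x i := by
  simp only [bit, IsOne]
  split_ifs <;> simp_all

theorem eval_checkGraph_eq_zero_iff (horder : σ.reg order = codedOrder x)
    (hmem : ∀ i, σ.mem i = bit x i) : (checkGraph.eval σ).reg bad = 0 ↔ σ.reg bad = 0 ∧
      (∀ u v : Fin (codedOrder x), IsOne x (adjIndex (codedOrder x) u v) →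
        IsOne x (adjIndex (codedOrder x) v u)) ∧
      ∀ u : Fin (codedOrder x), ¬ IsOne x (adjIndex (codedOrder x) u u) := by
  rw [checkGraph, eval_forPairs (f := fun u v =>
    bit x (adjIndex (codedOrder x) u v) - bit x (adjIndex (codedOrder x) v u) +
      if IsOne x (adjIndex (codedOrder x) u v) ∧ u = v then 1 else 0) (by decide)
    fun τ _ _ hrow hcol => by simp [hrow, hcol, hmem, horder, bit_ne_zero]]
  simp only [horder, Nat.add_eq_zero_iff, sum_eq_zero_iff, mem_range, Fin.forall_iff,
    bit_sub_bit_eq_zero, ite_eq_right_iff, one_ne_zero, imp_false, forall_and]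
  aesop

theorem eval_validate_eq_zero_iff (h : Parsed x p σ) : (validate.eval σ).reg bad = 0 ↔
    IsCode x ∧ σ.reg budget + σ.reg numT = p := by
  rw [validate, Cmd.eval_seq]
  refine (eval_checkGraph_eq_zero_iff (by simpa using h.order) (by simpa using h.mem)).trans ?_
  have numBits_iff : 1 - (x.length - headerLength (codedOrder x)) = 0 ↔
      headerLength (codedOrder x) < x.length := by omega
  have param_iff (a : ℕ) : a - p = 0 ∧ p - a = 0 ↔ a = p := by omega
  simp [IsCode, h.param, h.len, h.numBits, h.mem, one_sub_bit_eq_zero, numBits_iff, param_iff,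
    and_assoc, and_comm, and_left_comm]

end Readers

section Parse

/-- Reads an instance off the input. Afterwards `bad` is `0` if and only if the input encodes an
instance with the given parameter. -/
def parse : Cmd Var := readTerminals ;; readBudget ;; validate

/-- The variables that describe the instance. -/
def inputs : List Var := [len, order, param, budget, numT, edges, bound]

/-- The environment after an instance has been read. The memory above `len` is unspecified. -/
structure Ready (I : TSTInstance) (σ : Env Var) : Prop where
  order : σ.reg order = I.n
  param : σ.reg param = I.param
  budget : σ.reg budget = I.k
  numT : σ.reg numT = #I.T
  edges : σ.reg edges = I.param - 1
  bound : σ.reg bound = I.param ^ I.param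
  headerLength_le : headerLength I.n ≤ σ.reg len
  term (v : Fin I.n) : σ.mem (I.n + 1 + v) ≠ 0 ↔ v ∈ I.T
  adj (u v : Fin I.n) : σ.mem (adjIndex I.n u v) ≠ 0 ↔ I.G.Adj u v

variable {x : List Bool} {p : ℕ} {I : TSTInstance} {σ : Env Var}

theorem parsed_eval (h : Parsed x p σ) {c : Cmd Var} (hc : c.StoreFree)
    (hw : ∀ v ∈ [len, param, order, numBits, edges, bound], v ∉ c.writes) :
    Parsed x p (c.eval σ) := by
  simp only [List.forall_mem_cons] at hw
  constructor
  on_goal 1 => constructor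
  case mem => exact fun i => (congrFun (hc.eval_mem σ) i).trans (h.mem i)
  all_goals rw [c.eval_reg_of_notMem_writes (by simp [hw])]
  exacts [h.len, h.param, h.order, h.numBits, h.edges, h.bound]

theorem parsed_readTerminals (h : Parsed x p σ) : Parsed x p (readTerminals.eval σ) :=
  parsed_eval h (by simp [readTerminals, Cmd.StoreFree]) (by decide)

theorem sum_bit_encode (I : TSTInstance) :
    ∑ v ∈ range I.n, bit I.encode (I.n + 1 + v) = #I.T := by
  rw [sum_range, card_eq_sum_ones, ← filter_univ_mem I.T, sum_filter]
  exact sum_congr rfl fun v _ => if_congr (I.isOne_encode_term v) rfl rfl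

theorem eval_parse_reg_numT (h : Parsed I.encode p σ) : (parse.eval σ).reg numT = #I.T := by
  rw [← sum_bit_encode, ← I.codedOrder_encode, ← eval_readTerminals h]
  simp (disch := decide) [parse, Cmd.eval_reg_of_notMem_writes]

theorem eval_parse_reg_budget (h : Parsed I.encode p σ) : (parse.eval σ).reg budget = I.k := by
  rw [← I.suffixValue_encode, ← I.codedOrder_encode, ← eval_readBudget (parsed_readTerminals h)]
  simp (disch := decide) [parse, Cmd.eval_reg_of_notMem_writes]

theorem eval_parse_reg_bad_eq_zero_iff (h : Parsed x p σ) : (parse.eval σ).reg bad = 0 ↔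
    ∃ I : TSTInstance, I.encode = x ∧ I.param = p := by
  have isCode_iff : (parse.eval σ).reg bad = 0 ↔
      IsCode x ∧ (parse.eval σ).reg budget + (parse.eval σ).reg numT = p := by
    have hread := parsed_eval (parsed_readTerminals h) (c := readBudget)
      (by simp [readBudget, Cmd.StoreFree]) (by decide)
    simpa (disch := decide) [parse, Cmd.eval_reg_of_notMem_writes]
      using eval_validate_eq_zero_iff hread
  rw [isCode_iff, isCode_iff_exists_encode_eq, ← exists_and_right]
  refine exists_congr fun I => and_congr_right ?_
  rintro rfl
  rw [eval_parse_reg_budget h, eval_parse_reg_numT h, TSTInstance.param]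

theorem ready_parse (h : Parsed I.encode I.param σ) : Ready I (parse.eval σ) := by
  have hparse := parsed_eval h (c := parse)
    (by simp [parse, readTerminals, readBudget, validate, checkGraph, forPairs, Cmd.mul,
      Cmd.StoreFree]) (by decide)
  exact
  { order := hparse.order.trans I.codedOrder_encode
    param := hparse.param
    budget := eval_parse_reg_budget h
    numT := eval_parse_reg_numT h
    edges := hparse.edges
    bound := hparse.bound
    headerLength_le := I.headerLength_lt_length_encode.le.trans_eq hparse.len.symm
    term := fun v => by rw [hparse.mem, bit_ne_zero, I.isOne_encode_term]
    adj := fun u v => by rw [hparse.mem, bit_ne_zero, I.isOne_encode_adj] }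

theorem ready_eval (h : Ready I σ) {c : Cmd Var} (hc : c.StoresFrom len)
    (hw : ∀ v ∈ inputs, v ∉ c.writes) : Ready I (c.eval σ) := by
  simp only [inputs, List.forall_mem_cons] at hw
  have mem (a : ℕ) (ha : a < headerLength I.n) : (c.eval σ).mem a = σ.mem a :=
    hc.eval_mem_of_lt hw.1 (ha.trans_le h.headerLength_le)
  constructor
  case term =>
    intro v
    rw [mem _ (by have := v.2; unfold headerLength; omega), h.term]
  case adj =>
    intro u v
    rw [mem _ (adjIndex_lt u v), h.adj]
  all_goals rw [c.eval_reg_of_notMem_writes (by simp [hw])]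
  exacts [h.order, h.param, h.budget, h.numT, h.edges, h.bound, h.headerLength_le]

end Parse

section Domains

variable {I : TSTInstance} {σ : Env Var}

/-- The table of domains, which is stored row by row above the input: `v` is in the domain of the
node `j`. -/
def domain (I : TSTInstance) (σ : Env Var) (j : ℕ) (v : Fin I.n) : Prop :=
  σ.mem (σ.reg len + (I.n * j + v)) ≠ 0

theorem mul_add_inj {n i j : ℕ} {u v : Fin n} : n * i + u = n * j + v ↔ i = j ∧ u = v := by
  refine ⟨fun h => ?_, by rintro ⟨rfl, rfl⟩; rfl⟩
  have hij : i = j := by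
    simpa [Nat.mul_add_div u.pos, Nat.div_eq_of_lt u.2, Nat.div_eq_of_lt v.2] using
      congrArg (· / n) h
  subst hij
  exact ⟨rfl, Fin.ext (Nat.add_left_cancel h)⟩

theorem domain_congr {τ : Env Var} (hlen : τ.reg len = σ.reg len) (hmem : τ.mem = σ.mem) :
    domain I τ = domain I σ := by
  unfold domain
  rw [hlen, hmem]

theorem domain_put {i j x : ℕ} {u v : Fin I.n} :
    domain I (σ.put (σ.reg len + (I.n * j + v)) x) i u ↔
      if i = j ∧ u = v then x ≠ 0 else domain I σ i u := by
  split_ifs with h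
  · obtain ⟨rfl, rfl⟩ := h
    simp [domain]
  · rw [domain, domain, Env.put_mem_of_ne _ _ (by simpa [mul_add_inj] using h), Env.put_reg]

theorem domain_fillCell {off : Var} {pre : Cmd Var} {e : Exp Var} {j : ℕ} {v : Fin I.n}
    (hpre : pre.StoreFree) (hw : ∀ w ∈ [col, off, len], w ∉ pre.writes) (hcol : σ.reg col = v)
    (hoff : σ.reg off = I.n * j) (i : ℕ) (u : Fin I.n) :
    domain I ((pre ;; .store (len + (off + col)) e).eval σ) i u ↔
      if i = j ∧ u = v then e.eval (pre.eval σ) ≠ 0 else domain I σ i u := by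
  simp only [List.forall_mem_cons] at hw
  have reg {w : Var} (hw' : w ∉ pre.writes) := pre.eval_reg_of_notMem_writes hw' σ
  have domain_eq : domain I (pre.eval σ) = domain I σ :=
    domain_congr (reg hw.2.2.1) (hpre.eval_mem σ)
  rw [← domain_eq, ← domain_put, ← hoff, ← hcol, ← reg hw.1, ← reg hw.2.1]
  rfl

/-- Stores the values that `e` has after `pre`, for all vertices `col`, in the row of the table
whose offset is the value of `off`. -/
def fillRow (off : Var) (pre : Cmd Var) (e : Exp Var) : Cmd Var :=
  .loop col order (pre ;; .store (len + (off + col)) e)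

theorem domain_fillRow {off : Var} {pre : Cmd Var} {e : Exp Var} {j : ℕ} {P : Fin I.n → Prop}
    (h : Ready I σ) (hoff : σ.reg off = I.n * j) (hpre : pre.StoreFree)
    (hcol : col ∉ pre.writes) (hw : ∀ w ∈ off :: inputs, w ∉ col :: pre.writes)
    (he : ∀ τ, Ready I τ → (∀ w ∉ col :: pre.writes, τ.reg w = σ.reg w) →
      (∀ i ≠ j, ∀ u, domain I τ i u ↔ domain I σ i u) → ∀ v : Fin I.n, τ.reg col = v →
      (domain I τ j v ↔ domain I σ j v) → (e.eval (pre.eval τ) ≠ 0 ↔ P v)) :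
    (∀ v, domain I ((fillRow off pre e).eval σ) j v ↔ P v) ∧
      ∀ i ≠ j, ∀ v, domain I ((fillRow off pre e).eval σ) i v ↔ domain I σ i v := by
  have filled := Cmd.loop_induction (i := col) (b := order)
    (c := pre ;; .store (len + (off + col)) e) (σ := σ) (P := fun c τ => Ready I τ ∧
      (∀ v, domain I τ j v ↔ if v < c then P v else domain I σ j v) ∧
      ∀ i ≠ j, ∀ v, domain I τ i v ↔ domain I σ i v) ⟨h, by simp, by simp⟩ ?_
  · rw [h.order] at filled
    exact ⟨fun v => (filled.2.1 v).trans (by rw [if_pos v.2]), filled.2.2⟩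
  rintro c hc τ agree ⟨hτ, hj, hi⟩
  obtain ⟨v, rfl⟩ : ∃ v : Fin I.n, c = v := ⟨⟨c, hc.trans_eq h.order⟩, rfl⟩
  have hset : Ready I (τ.set col v) :=
    ready_eval hτ (c := col ≔ .const v) trivial (by simp [Cmd.writes, inputs])
  have reg (w : Var) (hw' : w ∉ col :: pre.writes) : (τ.set col v).reg w = σ.reg w := by
    rw [Env.set_reg_of_ne _ _ (by rintro rfl; exact hw' List.mem_cons_self),
      agree w (by simpa [Cmd.writes] using hw')]
  have value := he _ hset reg hi v (Env.set_reg_self ..)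
    ((hj v).trans (by rw [if_neg (lt_irrefl _)]))
  simp only [List.mem_cons, not_or, inputs] at hw
  have cell := domain_fillCell (I := I) (e := e) hpre (by simp [hcol, hw]) (Env.set_reg_self ..)
    ((reg off (by simp [hw])).trans hoff)
  refine ⟨ready_eval hset ⟨hpre.storesFrom len, _, rfl⟩ (by simp [Cmd.writes, inputs, hw]),
    fun u => ?_, fun i hij u => ?_⟩
  · rw [cell]
    obtain rfl | huv := eq_or_ne u v
    · simp only [and_self, if_true, value, Nat.lt_succ_self]
    · have := Fin.val_ne_of_ne huv
      simp only [huv, and_false, if_false, Nat.lt_succ_iff_lt_or_eq, this, or_false, ← hj]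
      rfl
  · rw [cell, if_neg (by simp [hij]), ← hi i hij]
    rfl

/-- Counts the terminals below `col`. -/
def countSeen : Cmd Var :=
  seen ≔ 0 ;; .loop row order (seen ≔ seen + .both (term row) (col - row))

/-- The truth value of `col` being in the initial domain of `node`, to be evaluated after
`countSeen`. The second summand tests for `node < budget` outside the terminals. -/
def inSlot : Exp Var :=
  .both (term col) (.isEq node (budget + seen)) + (1 - term col - (node + 1 - budget))

/-- Gives every node its initial domain. -/
def initDomains : Cmd Var :=
  .loop node param (.mul ix nodeOff order node ;; fillRow nodeOff countSeen inSlot)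

/-- Divides `quot` by `param`, with the remainder in `digit`. -/
def popDigit : Cmd Var :=
  newQuot ≔ 0 ;; multiple ≔ 0 ;;
  .loop ix bound (multiple ≔ multiple + param ;; newQuot ≔ newQuot + (1 - (multiple - quot))) ;;
  .mul ix multiple param newQuot ;;
  digit ≔ quot - multiple ;;
  quot ≔ newQuot

theorem popDigit_spec (hquot : σ.reg quot ≤ σ.reg bound) (hparam : 0 < σ.reg param) :
    (popDigit.eval σ).reg quot = σ.reg quot / σ.reg param ∧
      (popDigit.eval σ).reg digit = σ.reg quot % σ.reg param := by
  have divided := Cmd.loop_induction (i := ix) (b := bound)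
    (c := multiple ≔ multiple + param ;; newQuot ≔ newQuot + (1 - (multiple - quot)))
    (σ := (σ.set newQuot 0).set multiple 0)
    (P := fun j τ => τ.reg multiple = j * σ.reg param ∧
      τ.reg newQuot = min j (σ.reg quot / σ.reg param)) (by simp) ?_
  · have := (Nat.div_le_self _ (σ.reg param)).trans hquot
    simp (disch := decide) only [Env.set_reg_of_ne, min_eq_right this] at divided
    have sub := (σ.reg quot).mod_eq_sub_mul_div (k := σ.reg param)
    simp (disch := decide) [popDigit, Cmd.eval_reg_of_notMem_writes, divided.2, sub]
  · rintro j - τ agree ⟨hm, hq⟩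
    have := Nat.le_div_iff_mul_le (x := j + 1) (y := σ.reg quot) hparam
    suffices min j (σ.reg quot / σ.reg param) + (1 - ((j + 1) * σ.reg param - σ.reg quot)) =
        min (j + 1) (σ.reg quot / σ.reg param) by
      simpa (disch := decide) [hm, hq, agree, add_mul] using this
    omega

theorem eval_countSeen (h : Ready I σ) {v : Fin I.n} (hv : σ.reg col = v) :
    (countSeen.eval σ).reg seen = rank I.T v := by
  have counted := Cmd.loop_sum (i := row) (b := order) (acc := seen)
    (c := seen ≔ seen + .both (term row) (col - row)) (σ := σ.set seen 0)
    (f := fun u => if σ.mem (I.n + 1 + u) ≠ 0 ∧ u < v then 1 else 0) trivial (by decide)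
    fun u _ τ agree mem hu => by
      simp (disch := decide) [eval_term, agree, mem, hu, hv, h.order, Nat.sub_ne_zero_iff_lt]
  simp (disch := decide) only [Env.set_reg_of_ne, h.order] at counted
  refine counted.trans ?_
  rw [sum_range, rank, ← filter_univ_mem I.T, filter_filter, card_filter]
  simp [h.term]

theorem eval_inSlot (h : Ready I σ) {v : Fin I.n} (hv : σ.reg col = v) :
    inSlot.eval (countSeen.eval σ) ≠ 0 ↔ slot I.T I.k (σ.reg node) v := by
  have mem := Cmd.StoreFree.eval_mem (c := countSeen) (by simp [countSeen, Cmd.StoreFree]) σ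
  have test (a b c : ℕ) : (if a ≠ 0 ∧ b = c then 1 else 0) + (1 - a - (b + 1 - I.k)) ≠ 0 ↔
      ¬ a ≠ 0 ∧ b < I.k ∨ a ≠ 0 ∧ b = c := by
    split_ifs <;> omega
  rw [slot, ← h.term v, ← test]
  simp (disch := decide) [inSlot, eval_term, Cmd.eval_reg_of_notMem_writes, h.order, h.budget, mem,
    hv, eval_countSeen h hv]

theorem storesFrom_initDomains : initDomains.StoresFrom len := by
  simp [initDomains, countSeen, fillRow, Cmd.mul, Cmd.StoresFrom]

theorem domain_initDomains (h : Ready I σ) {j : ℕ} (hj : j < I.param) (v : Fin I.n) :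
    domain I (initDomains.eval σ) j v ↔ slot I.T I.k j v := by
  refine (Cmd.loop_induction (i := node) (b := param) (σ := σ)
    (P := fun c τ => Ready I τ ∧ ∀ i < c, ∀ v, domain I τ i v ↔ slot I.T I.k i v)
    ⟨h, by simp⟩ ?_).2 j (hj.trans_eq h.param.symm) v
  rintro c - τ - ⟨hτ, hdom⟩
  have hrow : Ready I ((Cmd.mul ix nodeOff order node).eval (τ.set node c)) :=
    ready_eval hτ (c := node ≔ .const c ;; .mul ix nodeOff order node)
      (by simp [Cmd.mul, Cmd.StoresFrom]) (by simp [Cmd.mul, Cmd.writes, inputs])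
  have domain_eq : domain I ((Cmd.mul ix nodeOff order node).eval (τ.set node c)) = domain I τ :=
    domain_congr (by simp) (by simp)
  obtain ⟨filled, kept⟩ := domain_fillRow (j := c) (P := slot I.T I.k c) hrow (off := nodeOff)
    (pre := countSeen) (e := inSlot)
    (by simp [hτ.order]) (by simp [countSeen, Cmd.StoreFree]) (by decide) (by decide)
    fun τ' hτ' agree _ v hv _ => by
      rw [eval_inSlot hτ' hv, agree node (by decide)]
      simp
  refine ⟨ready_eval hrow (by simp [fillRow, countSeen, Cmd.StoresFrom]) (by decide),
    fun i hi v => ?_⟩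
  obtain rfl | hic := eq_or_ne i c
  · exact filled v
  · exact (kept i hic v).trans ((iff_of_eq (by rw [domain_eq])).trans (hdom i (by omega) v))

/-- Counts the vertices in the domain of `node` that are adjacent or equal to `col`. -/
def countNeighbors : Cmd Var :=
  .mul ix colOff order col ;; flag ≔ 0 ;; .loop row order
    (flag ≔ flag + .both (.load (len + (nodeOff + row))) (adj colOff row + .isEq col row))

/-- Restricts the domain of `parent` to the vertices that are adjacent or equal to a vertex in the
domain of its child `node`. -/
def shrinkParent : Cmd Var :=
  .mul ix nodeOff order node ;; .mul ix parentOff order parent ;;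
    fillRow parentOff countNeighbors (.both (.load (len + (parentOff + col))) flag)

theorem sum_range_ne_zero_iff {n : ℕ} {f : ℕ → ℕ} :
    ∑ v ∈ range n, f v ≠ 0 ↔ ∃ v : Fin n, f v ≠ 0 := by
  simp [sum_eq_zero_iff, Fin.exists_iff]

theorem storeFree_countNeighbors : countNeighbors.StoreFree := by
  simp [countNeighbors, Cmd.mul, Cmd.StoreFree]

theorem eval_countNeighbors_ne_zero_iff (h : Ready I σ) {j : ℕ} (hj : σ.reg nodeOff = I.n * j)
    {v : Fin I.n} (hv : σ.reg col = v) :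
    (countNeighbors.eval σ).reg flag ≠ 0 ↔ ∃ u, domain I σ j u ∧ (I.G.Adj v u ∨ v = u) := by
  have counted := Cmd.loop_sum (i := row) (b := order) (acc := flag)
    (c := flag ≔ flag + .both (.load (len + (nodeOff + row))) (adj colOff row + .isEq col row))
    (σ := ((Cmd.mul ix colOff order col).eval σ).set flag 0)
    (f := fun u => if σ.mem (σ.reg len + (I.n * j + u)) ≠ 0 ∧
      σ.mem (adjIndex I.n v u) + (if (v : ℕ) = u then 1 else 0) ≠ 0 then 1 else 0)
    trivial (by decide) fun u _ τ agree mem hu => by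
      have hoff : τ.reg colOff = τ.reg order * v := by
        simp (disch := decide) [agree, hv]
      simp (disch := decide) [eval_adj hoff, agree, mem, hu, hj, hv, h.order]
  simp (disch := decide) only [Env.set_reg_of_ne, Cmd.eval_mul_reg_of_ne, Env.set_reg_self,
    zero_add, h.order] at counted
  refine (iff_of_eq (congrArg (· ≠ 0) counted)).trans (sum_range_ne_zero_iff.trans ?_)
  refine exists_congr fun u => ?_
  rw [domain, ← h.adj, ite_ne_right_iff]
  simp [Fin.ext_iff, imp_iff_not_or]

theorem domain_shrinkParent (h : Ready I σ) (hij : σ.reg parent ≠ σ.reg node) :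
    (∀ v, domain I (shrinkParent.eval σ) (σ.reg parent) v ↔ domain I σ (σ.reg parent) v ∧
      ∃ u, domain I σ (σ.reg node) u ∧ (I.G.Adj v u ∨ v = u)) ∧
    ∀ i ≠ σ.reg parent, ∀ v, domain I (shrinkParent.eval σ) i v ↔ domain I σ i v := by
  obtain ⟨σ', hσ'⟩ : ∃ σ', σ' =
    (Cmd.mul ix nodeOff order node ;; .mul ix parentOff order parent).eval σ := ⟨_, rfl⟩
  have hready : Ready I σ' := hσ' ▸ ready_eval h (by simp [Cmd.mul, Cmd.StoresFrom]) (by decide)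
  have domain_eq : domain I σ' = domain I σ := domain_congr (by simp [hσ']) (by simp [hσ'])
  have eval_eq : shrinkParent.eval σ = (fillRow parentOff countNeighbors
    (.both (.load (len + (parentOff + col))) flag)).eval σ' := by rw [hσ']; rfl
  rw [eval_eq, ← domain_eq]
  refine domain_fillRow hready (by simp [hσ', h.order]) storeFree_countNeighbors (by decide)
    (by decide) fun τ hτ agree kept v hv hcell => ?_
  have hnode : τ.reg nodeOff = I.n * σ.reg node := by
    simp (disch := decide) [agree, hσ', h.order]
  have hparent : τ.reg parentOff = I.n * σ.reg parent := by
    simp (disch := decide) [agree, hσ', h.order]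
  have mem := storeFree_countNeighbors.eval_mem τ
  rw [← hcell, ← exists_congr fun u => and_congr_left' (kept (σ.reg node) hij.symm u),
    ← eval_countNeighbors_ne_zero_iff hτ hnode hv]
  simp (disch := decide) [Cmd.eval_reg_of_notMem_writes, mem, hv, hparent, domain]

variable {m t : ℕ}

/-- Selects the last node of a tree with `param - edge` nodes and finds its parent. -/
def findParent : Cmd Var :=
  node ≔ param - (edge + 1) ;; popDigit ;; parent ≔ .min digit (.min (node - 1) (budget - 1))

/-- Removes all nodes but the root of the tree number `quot`, each after it has restricted the
domain of its parent. -/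
def shrinkTree : Cmd Var := .loop edge edges (findParent ;; shrinkParent)

/-- Increases `ans` if the domain of the root is not empty. -/
def testRoot : Cmd Var := .loop col order (ans ≔ ans + .load (len + col))

/-- Increases `ans` if the candidate tree number `tree` has a homomorphism to the graph. -/
def testTree : Cmd Var := quot ≔ tree ;; initDomains ;; shrinkTree ;; testRoot

theorem storeFree_findParent : findParent.StoreFree := by
  simp [findParent, popDigit, Cmd.mul, Cmd.StoreFree]

theorem storesFrom_shrinkParent : shrinkParent.StoresFrom len := by
  simp [shrinkParent, fillRow, countNeighbors, Cmd.mul, Cmd.StoresFrom]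

theorem storesFrom_shrinkTree : shrinkTree.StoresFrom len :=
  ⟨storeFree_findParent.storesFrom len, storesFrom_shrinkParent⟩

theorem storesFrom_testTree : testTree.StoresFrom len :=
  ⟨trivial, storesFrom_initDomains, storesFrom_shrinkTree, trivial⟩

theorem findParent_spec (h : Ready I σ) (hedge : σ.reg edge = t) (ht : t < I.param - 1)
    (hm : m ≤ I.param ^ I.param) (hquot : σ.reg quot = m / I.param ^ t) :
    (findParent.eval σ).reg node = I.param - (t + 1) ∧
      (findParent.eval σ).reg quot = m / I.param ^ (t + 1) ∧
      (findParent.eval σ).reg parent = parentOf I.param I.k m (I.param - (t + 1)) := by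
  obtain ⟨hq, hd⟩ := popDigit_spec (σ := σ.set node (I.param - (t + 1)))
    (by simpa (disch := decide) [hquot, h.bound] using (Nat.div_le_self _ _).trans hm)
    (by simpa (disch := decide) [h.param] using by omega)
  simp (disch := decide) only [Env.set_reg_of_ne, hquot, h.param] at hq hd
  have exponent : I.param - 1 - (I.param - (t + 1)) = t := by omega
  rw [Nat.div_div_eq_div_mul, ← pow_succ] at hq
  simp (disch := decide) [findParent, Cmd.eval_reg_of_notMem_writes, hedge, h.param, h.budget,
    parentOf, exponent, hq, hd]

theorem treeHom_domain_shrinkParent {par : ℕ → ℕ} {J : ℕ} (h : Ready I σ) (hJ : 1 ≤ J)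
    (hpar : ∀ j, 1 ≤ j → par j < j) (hnode : σ.reg node = J) (hparent : σ.reg parent = par J) :
    TreeHom (domain I (shrinkParent.eval σ)) I.G.Adj par J ↔
      TreeHom (domain I σ) I.G.Adj par (J + 1) := by
  obtain ⟨shrunk, kept⟩ := domain_shrinkParent h (by have := hpar J hJ; omega)
  rw [hparent, hnode] at shrunk
  rw [hparent] at kept
  exact (treeHom_succ_iff (fun j hj _ => hpar j hj) hJ (fun j _ hj => kept j hj) shrunk).symm

theorem shrinkTree_spec (h : Ready I σ) (hm : σ.reg quot ≤ I.param ^ I.param) :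
    (∃ v, domain I (shrinkTree.eval σ) 0 v) ↔
      TreeHom (domain I σ) I.G.Adj (parentOf I.param I.k (σ.reg quot)) I.param := by
  set par := parentOf I.param I.k (σ.reg quot)
  have hp : 1 ≤ I.param := I.k_pos.trans_le (Nat.le_add_right _ _)
  have shrunk := Cmd.loop_induction (i := edge) (b := edges) (c := findParent ;; shrinkParent)
    (σ := σ) (P := fun t τ => Ready I τ ∧ τ.reg quot = σ.reg quot / I.param ^ t ∧
      (TreeHom (domain I τ) I.G.Adj par (I.param - t) ↔
        TreeHom (domain I σ) I.G.Adj par I.param)) ⟨h, by simp, Iff.rfl⟩ ?_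
  · rw [h.edges, Nat.sub_sub_self hp, treeHom_one] at shrunk
    exact shrunk.2.2
  rintro t ht τ - ⟨hτ, hquot, htree⟩
  rw [h.edges] at ht
  have hset : Ready I (τ.set edge t) :=
    ready_eval hτ (c := edge ≔ .const t) trivial (by simp [Cmd.writes, inputs])
  have hfind : Ready I (findParent.eval (τ.set edge t)) :=
    ready_eval hset (storeFree_findParent.storesFrom len) (by decide)
  obtain ⟨hnode, hquot', hparent⟩ := findParent_spec hset (Env.set_reg_self ..) ht hm
    (by simpa (disch := decide) using hquot)
  have domain_eq : domain I (findParent.eval (τ.set edge t)) = domain I τ :=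
    domain_congr (by simp (disch := decide) [Cmd.eval_reg_of_notMem_writes])
      (storeFree_findParent.eval_mem _)
  have removed := treeHom_domain_shrinkParent hfind (by omega)
    (fun j hj => (parentOf_lt I.k_pos hj).1) hnode hparent
  rw [domain_eq, show I.param - (t + 1) + 1 = I.param - t by omega] at removed
  refine ⟨ready_eval hfind storesFrom_shrinkParent (by decide), ?_, removed.trans htree⟩
  simpa (disch := decide) [Cmd.eval_reg_of_notMem_writes] using hquot'

theorem eval_testRoot_ne_zero_iff (h : Ready I σ) :
    (testRoot.eval σ).reg ans ≠ 0 ↔ σ.reg ans ≠ 0 ∨ ∃ v, domain I σ 0 v := by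
  have counted := Cmd.loop_sum (i := col) (b := order) (acc := ans)
    (c := ans ≔ ans + .load (len + col)) (σ := σ) (f := fun v => σ.mem (σ.reg len + v))
    trivial (by decide)
    fun v _ τ agree mem hv => by simp (disch := decide) [agree, mem, hv]
  rw [testRoot, counted, h.order, Ne, Nat.add_eq_zero_iff, not_and_or]
  refine or_congr_right (sum_range_ne_zero_iff.trans ?_)
  simp [domain]

theorem testTree_spec (h : Ready I σ) (htree : σ.reg tree ≤ I.param ^ I.param) :
    (testTree.eval σ).reg ans ≠ 0 ↔ σ.reg ans ≠ 0 ∨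
      TreeHom (slot I.T I.k) I.G.Adj (parentOf I.param I.k (σ.reg tree)) I.param := by
  have hset : Ready I ((quot ≔ tree).eval σ) := ready_eval h trivial (by decide)
  have hinit : Ready I (initDomains.eval ((quot ≔ tree).eval σ)) :=
    ready_eval hset storesFrom_initDomains (by decide)
  have hquot : (initDomains.eval ((quot ≔ tree).eval σ)).reg quot = σ.reg tree := by
    simp (disch := decide) [Cmd.eval_reg_of_notMem_writes]
  have shrunk := shrinkTree_spec hinit (hquot.trans_le htree)
  rw [hquot, treeHom_congr (fun j hj v => domain_initDomains hset hj v) fun _ _ _ => rfl] at shrunk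
  rw [← shrunk, testTree, Cmd.eval_seq, Cmd.eval_seq, Cmd.eval_seq, eval_testRoot_ne_zero_iff
    (ready_eval hinit storesFrom_shrinkTree (by decide))]
  simp (disch := decide) [Cmd.eval_reg_of_notMem_writes]

end Domains

section Search

variable {I : TSTInstance} {σ : Env Var} {x : List Bool} {p : ℕ}

/-- Increases `ans` if the graph has exactly two terminals and these are adjacent. -/
def searchEdge : Cmd Var :=
  forPairs ans (.both (.both (term row) (term col)) (.both (adj rowOff col) (.isEq numT 2)))

/-- Increases `ans` if some candidate tree has a homomorphism to the graph. -/
def searchTrees : Cmd Var := .loop tree bound testTree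

/-- Computes a number that is nonzero if and only if the instance is a yes-instance. -/
def search : Cmd Var := ans ≔ 0 ;; searchEdge ;; searchTrees

theorem eval_searchEdge_ne_zero_iff (h : Ready I σ) :
    (searchEdge.eval σ).reg ans ≠ 0 ↔ σ.reg ans ≠ 0 ∨
      #I.T = 2 ∧ ∃ u ∈ I.T, ∃ v ∈ I.T, I.G.Adj u v := by
  have counted := eval_forPairs (σ := σ) (acc := ans)
    (e := .both (.both (term row) (term col)) (.both (adj rowOff col) (.isEq numT 2)))
    (f := fun u v => if (σ.mem (I.n + 1 + u) ≠ 0 ∧ σ.mem (I.n + 1 + v) ≠ 0) ∧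
      σ.mem (adjIndex I.n u v) ≠ 0 ∧ #I.T = 2 then 1 else 0) (by decide)
    fun τ mem agree hadj _ => by
      simp (disch := decide) [eval_term, mem, agree, hadj, h.order, h.numT]
  rw [searchEdge, counted, h.order, Ne, Nat.add_eq_zero_iff, not_and_or]
  refine or_congr_right (sum_range_ne_zero_iff.trans ?_)
  simp only [sum_range_ne_zero_iff, ite_ne_right_iff, h.term, h.adj]
  aesop

theorem eval_searchTrees_ne_zero_iff (h : Ready I σ) :
    (searchTrees.eval σ).reg ans ≠ 0 ↔ σ.reg ans ≠ 0 ∨ ∃ m < I.param ^ I.param,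
      TreeHom (slot I.T I.k) I.G.Adj (parentOf I.param I.k m) I.param := by
  rw [← h.bound]
  refine (Cmd.loop_induction (P := fun t τ => Ready I τ ∧ (τ.reg ans ≠ 0 ↔ σ.reg ans ≠ 0 ∨
    ∃ m < t, TreeHom (slot I.T I.k) I.G.Adj (parentOf I.param I.k m) I.param))
    ⟨h, by simp⟩ ?_).2
  rintro t ht τ - ⟨hτ, hans⟩
  have hset : Ready I (τ.set tree t) :=
    ready_eval hτ (c := tree ≔ .const t) trivial (by simp [Cmd.writes, inputs])
  refine ⟨ready_eval hset storesFrom_testTree (by decide), ?_⟩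
  rw [testTree_spec hset (by simpa using ht.le.trans_eq h.bound), Env.set_reg_of_ne _ _ (by decide),
    hans, Env.set_reg_self, or_assoc, Nat.exists_lt_succ_right]

theorem eval_search_ne_zero_iff (h : Ready I σ) : (search.eval σ).reg ans ≠ 0 ↔ I.IsYes := by
  have hset : Ready I ((ans ≔ 0).eval σ) := ready_eval h trivial (by decide)
  have hedge : Ready I (searchEdge.eval ((ans ≔ 0).eval σ)) :=
    ready_eval hset (by simp [searchEdge, forPairs, Cmd.mul, Cmd.StoresFrom]) (by decide)
  rw [search, Cmd.eval_seq, Cmd.eval_seq, eval_searchTrees_ne_zero_iff hedge,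
    eval_searchEdge_ne_zero_iff hset, I.isYes_iff_exists_treeHom]
  simp

/-- Decides the instance that has been read. -/
def decideInstance : Cmd Var := parse ;; search ;; len ≔ .both (1 - bad) ans

/-- The program that decides Terminal Steiner Tree. It is divided such that the bounds of the loops
of each part are computed before that part. -/
def solver : Cmd Var := readOrder ;; layout ;; decideInstance

theorem input_readOrder (h : Input x p σ) : Input x p (readOrder.eval σ) where
  len := (readOrder.eval_reg_of_notMem_writes (by decide) σ).trans h.len
  param := (readOrder.eval_reg_of_notMem_writes (by decide) σ).trans h.param
  mem i := by rw [Cmd.StoreFree.eval_mem (by simp [readOrder, Cmd.StoreFree]), h.mem]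

theorem parsed_layout_readOrder (h : Input x p σ) : Parsed x p (layout.eval (readOrder.eval σ)) :=
  parsed_layout (input_readOrder h) (eval_readOrder_reg_order h)

theorem eval_decideInstance_ne_zero_iff (h : Parsed x p σ) :
    (decideInstance.eval σ).reg len ≠ 0 ↔ (x, p) ∈ terminalSteinerTree := by
  have eval_len : (decideInstance.eval σ).reg len ≠ 0 ↔
      (parse.eval σ).reg bad = 0 ∧ (search.eval (parse.eval σ)).reg ans ≠ 0 := by
    have not_ne_zero (b : ℕ) : 1 - b ≠ 0 ↔ b = 0 := by omega
    simp (disch := decide) [decideInstance, Cmd.eval_reg_of_notMem_writes, not_ne_zero]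
  rw [eval_len, eval_parse_reg_bad_eq_zero_iff h]
  constructor
  · rintro ⟨⟨I, rfl, rfl⟩, hans⟩
    exact ⟨I, rfl, rfl, (eval_search_ne_zero_iff (ready_parse h)).1 hans⟩
  · rintro ⟨I, rfl, rfl, hyes⟩
    exact ⟨⟨I, rfl, rfl⟩, (eval_search_ne_zero_iff (ready_parse h)).2 hyes⟩

end Search

theorem exists_time_solver_le :
    ∃ C d, ∀ x p σ, Input x p σ → solver.time σ ≤ C * (x.length + p + p ^ p + 1) ^ d := by
  obtain ⟨C₁, d₁, h₁⟩ := readOrder.exists_time_le (by decide)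
  obtain ⟨C₂, d₂, h₂⟩ := layout.exists_time_le (by decide)
  obtain ⟨C₃, d₃, h₃⟩ := decideInstance.exists_time_le (by decide)
  refine ⟨C₁ + (C₂ + C₃), d₁ + (d₂ + d₃), fun x p σ h => ?_⟩
  have parsed := parsed_layout_readOrder h
  have order_le := codedOrder_le_length x
  have le₁ : readOrder.time σ ≤ C₁ * (x.length + p + p ^ p + 1) ^ d₁ :=
    h₁ _ σ (List.forall_mem_singleton.2 (by rw [h.len]; omega))
  have le₂ : layout.time (readOrder.eval σ) ≤ C₂ * (x.length + p + p ^ p + 1) ^ d₂ :=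
    h₂ _ _ (by simpa [layout, computeBound, Cmd.mul, Cmd.loopBounds, eval_readOrder_reg_order h,
      (input_readOrder h).param] using by omega)
  have le₃ : decideInstance.time (layout.eval (readOrder.eval σ)) ≤
      C₃ * (x.length + p + p ^ p + 1) ^ d₃ := by
    have bounds : decideInstance.loopBounds ⊆ [order, numBits, edges, param, bound] := by decide
    have bound_le : ∀ b ∈ [order, numBits, edges, param, bound],
        (layout.eval (readOrder.eval σ)).reg b ≤ x.length + p + p ^ p := by
      simp only [List.forall_mem_cons, List.not_mem_nil, false_imp_iff, implies_true,
        and_true, parsed.order, parsed.numBits, parsed.edges, parsed.param, parsed.bound]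
      omega
    exact h₃ _ _ fun b hb => bound_le b (bounds hb)
  exact (add_le_add le₁ <| (add_le_add le₂ le₃).trans <|
    mul_pow_add_mul_pow_le (Nat.succ_pos _) ..).trans <|
      mul_pow_add_mul_pow_le (Nat.succ_pos _) ..

/-- The environment that the machine starts in, where every variable lives in the register of its
index. -/
def initEnv (x : List Bool) (p : ℕ) : Env Var where
  reg v := (init x p).reg v.ctorIdx
  mem := (init x p).mem

theorem input_initEnv (x : List Bool) (p : ℕ) : Input x p (initEnv x p) where
  len := rfl
  param := rfl
  mem _ := rfl

theorem ctorIdx_injective : Function.Injective Var.ctorIdx :=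
  Function.LeftInverse.injective Var.ofNat_ctorIdx

theorem ctorIdx_lt (v : Var) : v.ctorIdx < 29 := by cases v <;> decide

theorem exists_runs_solver (x : List Bool) (p : ℕ) :
    ∃ s, Runs (solver.code Var.ctorIdx 29) (init x p) s (solver.time (initEnv x p)) ∧
      (s.reg 0 ≠ 0 ↔ (x, p) ∈ terminalSteinerTree) := by
  obtain ⟨s, run, realizes, -⟩ := solver.implements_code ctorIdx_injective ctorIdx_lt
    (initEnv x p) (init x p) ⟨rfl, fun _ => rfl⟩
  have output : s.reg 0 = (solver.eval (initEnv x p)).reg len := realizes.2 len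
  exact ⟨s, run, output ▸
    eval_decideInstance_ne_zero_iff (parsed_layout_readOrder (input_initEnv x p))⟩

theorem computable_mul_pow_self_pow (C d : ℕ) :
    Computable fun p : ℕ => C * (p + p ^ p + 1) ^ d := by
  have primrec_pow : Primrec₂ ((· ^ ·) : ℕ → ℕ → ℕ) := Primrec₂.unpaired'.1 Nat.Primrec.pow
  have base : Primrec fun p : ℕ => p + p ^ p + 1 :=
    Primrec.nat_add.comp (Primrec.nat_add.comp .id (primrec_pow.comp .id .id)) (.const 1)
  exact (Primrec.nat_mul.comp (.const C) (primrec_pow.comp base (.const d))).to_comp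

end TSTSolver

/-- Terminal Steiner Tree parameterized by `k + |T|` is fixed-parameter tractable. -/
theorem mainTheorem9 : terminalSteinerTree.IsFPT := by
  obtain ⟨C, d, time_le⟩ := TSTSolver.exists_time_solver_le
  refine ⟨TSTSolver.solver.code TSTSolver.Var.ctorIdx 29, fun p => C * (p + p ^ p + 1) ^ d, d,
    TSTSolver.computable_mul_pow_self_pow C d, fun x p => ?_⟩
  obtain ⟨s, run, accepts⟩ := TSTSolver.exists_runs_solver x p
  refine ⟨s, _, run, (time_le x p _ (TSTSolver.input_initEnv x p)).trans ?_, accepts⟩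
  calc C * (x.length + p + p ^ p + 1) ^ d
      ≤ C * ((p + p ^ p + 1) * (x.length + 1)) ^ d := by
        gcongr
        nlinarith [Nat.zero_le ((p + p ^ p) * x.length)]
    _ = C * (p + p ^ p + 1) ^ d * (x.length + 1) ^ d := by rw [mul_pow, mul_assoc]
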